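/- **Lemma 1.1.** Let $m\ge 1$ be an integer and let $u\in W^{m-\frac12,2}(\mathbb R^{2m-1})$ (real- or complex-valued). Let $\mathbb R^{2m}_+=\{(x,y):x\in\mathbb R^{2m-1},\,y>0\}$ and let $U\in W^{m,2}(\mathbb R^{2m}_+)$ satisfy $(-\Delta)^mU=0$ in $\mathbb R^{2m}_+$ (in the sense of distributions) together with the boundary conditions, in the sense of traces, $$\Delta^kU(x,y)\big|_{y=0}=\frac{\Gamma(m)\,\Gamma(m-\frac12-k)}{\Gamma(m-k)\,\Gamma(m-\frac12)}\,\Delta_x^ku(x),\qquad 0\le k\le\Big[\frac{m-1}{2}\Big],$$ $$\partial_y\Delta^kU(x,y)\big|_{y=0}=0,\qquad 0\le k\le\Big[\frac{m-2}{2}\Big]$$ (for $m=1$ the second condition is empty). Then $$\int_{\mathbb R^{2m}_+}|\nabla^mU(x,y)|^2\,dx\,dy=\frac{\Gamma(m)\,\Gamma(\frac12)}{\Gamma(m-\frac12)}\int_{\mathbb R^{2m-1}}\big|(-\Delta)^{\frac{2m-1}{4}}u\big|^2\,dx ,$$ where $\nabla^m=\Delta^{m/2}$ if $m$ is even and $\nabla^m=\nabla\Delta^{(m-1)/2}$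 if $m$ is odd, and $(-\Delta)^{\frac{2m-1}{4}}$ is the Fourier multiplier with symbol $|\xi|^{\frac{2m-1}{2}}$. In particular the left-hand integrand is integrable. -/

import Mathlib

open MeasureTheory TopologicalSpace

namespace HalfSpace

open scoped Distributions FourierTransform Laplacian SchwartzMap

/-- The boundary space `ℝ^d`, with its Euclidean norm. -/
abbrev Bdry (d : ℕ) : Type := EuclideanSpace ℝ (Fin d)

/-- The open upper half space `ℝ^{d+1}_+ = {(x, y) : x ∈ ℝ^d, y > 0}`, as an open subset of
`ℝ^d × ℝ`.  The measure on `ℝ^d × ℝ` is Lebesgue measure. -/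
def upper (d : ℕ) : Opens (Bdry d × ℝ) :=
  ⟨{p | 0 < p.2}, isOpen_lt continuous_const continuous_snd⟩

/-- The unit vector in the direction of the `i`-th tangential variable `x_i`. -/
noncomputable def ex {d : ℕ} (i : Fin d) : Bdry d × ℝ := (EuclideanSpace.single i 1, 0)

/-- The unit vector in the direction of the normal variable `y`. -/
def ey (d : ℕ) : Bdry d × ℝ := (0, 1)

/-- `g` is the weak derivative of `f` on the upper half space in the direction `v`. -/
def HasWeakDeriv {d : ℕ} (v : Bdry d × ℝ) (f g : Bdry d × ℝ → ℂ) : Prop :=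
  LocallyIntegrableOn g (upper d : Set (Bdry d × ℝ)) ∧
    ∀ φ : 𝓓(upper d, ℝ),
      ∫ p in upper d, fderiv ℝ φ p v • f p = -∫ p in upper d, φ p • g p

open Classical in
/-- The weak derivative of `f` on the upper half space in the direction `v` (unique up to null
sets; `0` by convention if there is none). -/
noncomputable def weakDeriv {d : ℕ} (v : Bdry d × ℝ) (f : Bdry d × ℝ → ℂ) : Bdry d × ℝ → ℂ :=
  if h : ∃ g, HasWeakDeriv v f g then h.choose else 0

/-- The Sobolev space `W^{k,2}` of the upper half space: `f ∈ L²`, and the weak derivatives of `f`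
of all orders up to `k` exist and lie in `L²`. -/
def MemW {d : ℕ} : ℕ → (Bdry d × ℝ → ℂ) → Prop
  | 0, f => MemLp f 2 (volume.restrict (upper d : Set (Bdry d × ℝ)))
  | k + 1, f => MemLp f 2 (volume.restrict (upper d : Set (Bdry d × ℝ))) ∧
      ∀ v : Bdry d × ℝ, ∃ g, HasWeakDeriv v f g ∧ MemW k g

/-- The Laplacian `Δ = Δ_x + ∂_y²` of a smooth function on `ℝ^d × ℝ`. -/
noncomputable def lap {d : ℕ} (φ : Bdry d × ℝ → ℝ) : Bdry d × ℝ → ℝ := fun p =>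
  (Δ fun x : Bdry d => φ (x, p.2)) p.1 + iteratedDeriv 2 (fun y : ℝ => φ (p.1, y)) p.2

/-- `g = Δ^k f` weakly on the upper half space. -/
def HasWeakLapPow {d : ℕ} (k : ℕ) (f g : Bdry d × ℝ → ℂ) : Prop :=
  LocallyIntegrableOn g (upper d : Set (Bdry d × ℝ)) ∧
    ∀ φ : 𝓓(upper d, ℝ),
      ∫ p in upper d, (lap^[k] φ) p • f p = ∫ p in upper d, φ p • g p

open Classical in
/-- The weak power `Δ^k f` of the Laplacian on the upper half space (unique up to null sets; `0` by
convention if there is none). -/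
noncomputable def weakLapPow {d : ℕ} (k : ℕ) (f : Bdry d × ℝ → ℂ) : Bdry d × ℝ → ℂ :=
  if h : ∃ g, HasWeakLapPow k f g then h.choose else 0

/-- `|∇^m f|²`, where `∇^m = Δ^{m/2}` for even `m` and `∇^m = ∇ Δ^{(m-1)/2}` for odd `m`. -/
noncomputable def gradPowSq {d : ℕ} (m : ℕ) (f : Bdry d × ℝ → ℂ) (p : Bdry d × ℝ) : ℝ :=
  if Even m then ‖weakLapPow (m / 2) f p‖ ^ 2
  else (∑ i : Fin d, ‖weakDeriv (ex i) (weakLapPow (m / 2) f) p‖ ^ 2) +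
    ‖weakDeriv (ey d) (weakLapPow (m / 2) f) p‖ ^ 2

/-- `g ∈ L²(ℝ^d)` is the trace `f|_{y=0}` of the function `f ∈ W^{1,2}` of the upper half space:
Green's formula `∫_{y>0} (∂_y φ f + φ ∂_y f) = -∫ φ(x,0) g(x) dx` holds for all
`φ ∈ C_c^∞(ℝ^d × ℝ)`.  These `φ` need not vanish at `y = 0`, so the formula determines `g`. -/
def HasTrace {d : ℕ} (f : Bdry d × ℝ → ℂ) (g : Bdry d → ℂ) : Prop :=
  MemW 1 f ∧ MemLp g 2 volume ∧
    ∀ φ : 𝓓((⊤ : Opens (Bdry d × ℝ)), ℝ),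
      ∫ p in upper d, (fderiv ℝ φ p (ey d) • f p + φ p • weakDeriv (ey d) f p) =
        -∫ x : Bdry d, φ (x, 0) • g x

open Classical in
/-- The fractional Laplacian `(-Δ)^σ` on `ℝ^d`, as a Fourier multiplier on its domain in `L²`.
Its symbol is `(2π|ξ|)^{2σ}`, since the Fourier transform has the kernel `e^{-2πi x·ξ}`.
(The value outside the domain is `0` by convention.) -/
noncomputable def fracLap {d : ℕ} (σ : ℝ) (u : Lp ℂ 2 (volume : Measure (Bdry d))) :
    Lp ℂ 2 (volume : Measure (Bdry d)) :=
  if h : MemLp (fun ξ : Bdry d => ((2 * Real.pi * ‖ξ‖) ^ (2 * σ)) • (𝓕 u) ξ) 2 volume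
  then 𝓕⁻ (h.toLp) else 0

/-- The distribution `Δ_x^k u` on `ℝ^d` is (represented by) the function `g ∈ L²`. -/
def IsBdryLapPow {d : ℕ} (k : ℕ) (u g : Lp ℂ 2 (volume : Measure (Bdry d))) : Prop :=
  (fun T : 𝓢'(Bdry d, ℂ) => Δ T)^[k] (Lp.toTemperedDistribution u) = Lp.toTemperedDistribution g

end HalfSpace

/-! A Fourier transform in `x` alone turns the problem into a family of ordinary differential
equations on the half line. At frequency `ξ`, with `l = 2π‖ξ‖`, the transformed function `w` lies in
`L²(0, ∞)` and solves `(∂_y² - l²)^m w = 0` weakly. Hence `w = Q e^{-ly}` with `Q` a polynomial of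
degree less than `m` (`exists_poly_of_weak_modeLap`).

One explicit solution is `θ_{m-1} e^{-ly}`, with `θ_n` the reverse Bessel polynomials. The operator
`∂_y² - l²` lowers the index of `θ_n e^{-ly}` by one, and the normal derivative of `θ_n e^{-ly}` at
`0` vanishes for `n ≥ 1`. Its boundary data are therefore exactly those prescribed, Gamma quotients
included. Green's formula writes its energy as a boundary sum in which only the term `k = 0`
survives, and this term yields the constant (`expEnergy_revBessel`).

A general `Q` with the same data has the same energy: the difference from the multiple of the Bessel
solution has zero data, so by Green's formula it is orthogonal, in the energy form, to all solutions
(`expEnergy_of_boundary`).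

To reach the half space, a function in `L²` is viewed as an `L²(0, ∞)`-valued function of `x` and
transformed there (`fiberFourier`). Testing against products `η(x) χ(y)` shows that for almost every
`ξ` the equation and the traces hold for all `χ` at once (`ae_forall_pair_modeLap_iterate`,
`ae_forall_trace`). The mode identity `ae_mode_energy` is then integrated over `ξ`, with Plancherel
on both sides. -/

namespace HalfSpace

open Polynomial Set

/-! ### Polynomials times `e^{-ly}`: Green's formula and the energy form. -/

/-- The derivative of `Q e^{-l y}`, divided by `e^{-l y}`. -/
noncomputable def expDeriv (l : ℝ) : ℝ[X] →ₗ[ℝ] ℝ[X] := derivative - l • LinearMap.id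

/-- The operator `∂_y² - l²` applied to `Q e^{-l y}`, divided by `e^{-l y}`. -/
noncomputable def expLap (l : ℝ) : ℝ[X] →ₗ[ℝ] ℝ[X] :=
  expDeriv l ∘ₗ expDeriv l - (l ^ 2) • LinearMap.id

theorem expDeriv_apply (l : ℝ) (Q : ℝ[X]) : expDeriv l Q = derivative Q - C l * Q := by
  simp [expDeriv, smul_eq_C_mul]

theorem expLap_eq (l : ℝ) (Q : ℝ[X]) :
    expLap l Q = expDeriv l (expDeriv l Q) - C (l ^ 2) * Q := by
  simp [expLap, smul_eq_C_mul]

theorem expLap_apply (l : ℝ) (Q : ℝ[X]) :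
    expLap l Q = derivative (derivative Q) - C (2 * l) * derivative Q := by
  simp only [expLap_eq, expDeriv_apply, derivative_sub, derivative_mul, derivative_C, C_pow, C_mul,
    C_ofNat]
  ring

/-- After conjugation by `e^{-ly}` the operator is `∂² - 2l∂`, whose two terms both lower the
degree. -/
theorem expLap_pow_eq_zero (l : ℝ) {n : ℕ} : ∀ {Q : ℝ[X]}, Q.natDegree < n →
    (expLap l ^ n) Q = 0 := by
  induction n with
  | zero => intro Q h; omega
  | succ n ih =>
    intro Q h
    rw [pow_succ, Module.End.mul_apply]
    have h2 : (expLap l Q).natDegree ≤ Q.natDegree - 1 := by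
      rw [expLap_apply]
      refine (natDegree_sub_le _ _).trans (max_le ?_ ?_)
      · refine (natDegree_derivative_le _).trans ?_
        have := natDegree_derivative_le Q
        omega
      · exact (natDegree_C_mul_le _ _).trans (natDegree_derivative_le Q)
    -- The truncated bound `Q.natDegree - 1` does not express that constants are annihilated, so
    -- they are treated separately.
    rcases Nat.eq_zero_or_pos n with rfl | hn
    · obtain ⟨c, rfl⟩ := natDegree_eq_zero.1 (show Q.natDegree = 0 by omega)
      simp [expLap_apply]
    · exact ih (by omega)

theorem isBigO_poly_mul_exp (Q : ℝ[X]) {b c : ℝ} (hb : c < b) :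
    (fun y : ℝ => Q.eval y * Real.exp (-b * y)) =O[Filter.atTop] fun y => Real.exp (-c * y) := by
  have hd : 0 < b - c := sub_pos.2 hb
  have h1 : Filter.Tendsto (fun y : ℝ => (b - c) * y) Filter.atTop Filter.atTop :=
    Filter.tendsto_id.const_mul_atTop hd
  -- The known limit has denominator `e^s`; the substitution `s = (b - c) y` brings the quotient to
  -- that form.
  have h2 := ((Q.comp (C (b - c)⁻¹ * X)).tendsto_div_exp_atTop).comp h1
  have h3 := (h2.isBigO_one ℝ).mul
    (Asymptotics.isBigO_refl (fun y => Real.exp (-c * y)) Filter.atTop)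
  refine (Asymptotics.isBigO_congr ?_ ?_).1 h3
  · refine Filter.Eventually.of_forall fun y => ?_
    have : (b - c)⁻¹ * ((b - c) * y) = y := by field_simp
    simp only [Function.comp, eval_comp, eval_mul, eval_C, eval_X, this]
    rw [div_mul_eq_mul_div, div_eq_iff (Real.exp_ne_zero _), mul_assoc, ← Real.exp_add]
    ring_nf
  · exact Filter.Eventually.of_forall fun y => by simp

theorem integrableOn_poly_mul_exp (Q : ℝ[X]) {b : ℝ} (hb : 0 < b) :
    IntegrableOn (fun y : ℝ => Q.eval y * Real.exp (-b * y)) (Ioi 0) := by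
  refine integrable_of_isBigO_exp_neg (half_pos hb) (by fun_prop) ?_
  simpa using isBigO_poly_mul_exp Q (half_lt_self hb)

theorem tendsto_poly_mul_exp (Q : ℝ[X]) {b : ℝ} (hb : 0 < b) :
    Filter.Tendsto (fun y : ℝ => Q.eval y * Real.exp (-b * y)) Filter.atTop (nhds 0) := by
  refine (isBigO_poly_mul_exp Q (half_lt_self hb)).trans_tendsto ?_
  have := Real.tendsto_exp_neg_atTop_nhds_zero.comp
    (Filter.tendsto_id.const_mul_atTop (half_pos hb))
  refine this.congr fun y => by simp

/-- The functional `Q ↦ ∫_0^∞ Q e^{-2ly} dy` on polynomials. -/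
noncomputable def expInt (l : ℝ) (Q : ℝ[X]) : ℝ :=
  ∫ y in Ioi (0 : ℝ), Q.eval y * Real.exp (-(2 * l) * y)

section

variable {l : ℝ} (hl : 0 < l)

include hl

theorem expInt_add (P Q : ℝ[X]) : expInt l (P + Q) = expInt l P + expInt l Q := by
  have h := fun R => integrableOn_poly_mul_exp R (b := 2 * l) (by positivity)
  simp only [expInt]
  rw [← integral_add (h P) (h Q)]
  refine integral_congr_ae (.of_forall fun y => ?_)
  simp [add_mul]

omit hl in
theorem expInt_C_mul (c : ℝ) (Q : ℝ[X]) : expInt l (C c * Q) = c * expInt l Q := by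
  simp only [expInt]
  rw [← integral_const_mul]
  refine integral_congr_ae (.of_forall fun y => ?_)
  simp only [eval_mul, eval_C, mul_assoc]

theorem expInt_sub (P Q : ℝ[X]) : expInt l (P - Q) = expInt l P - expInt l Q := by
  have := expInt_add hl (P - Q) Q
  rw [sub_add_cancel] at this
  linarith

/-- The derivative of `P R e^{-2ly}` splits into the two `expDeriv` terms, each absorbing one `-l`.
The boundary term at infinity vanishes by decay. -/
theorem expInt_parts (P R : ℝ[X]) :
    expInt l (expDeriv l P * R) = -expInt l (P * expDeriv l R) - P.eval 0 * R.eval 0 := by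
  have hb : 0 < 2 * l := by positivity
  have h1 : ∫ y in Ioi (0 : ℝ), (expDeriv l P * R + P * expDeriv l R).eval y
      * Real.exp (-(2 * l) * y) = 0 - (P * R).eval 0 * Real.exp (-(2 * l) * 0) := by
    refine integral_Ioi_of_hasDerivAt_of_tendsto' (fun y _ => ?_)
      (integrableOn_poly_mul_exp _ hb) (tendsto_poly_mul_exp (P * R) hb)
    have h2 := ((P * R).hasDerivAt y).mul
      (((hasDerivAt_id y).const_mul (-(2 * l))).exp)
    refine h2.congr_deriv ?_
    simp only [expDeriv_apply, eval_add, eval_mul, eval_sub, eval_C, derivative_mul, id]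
    ring
  have h3 := expInt_add hl (expDeriv l P * R) (P * expDeriv l R)
  rw [expInt, h1] at h3
  simp only [eval_mul, mul_zero, Real.exp_zero] at h3
  linarith

theorem expInt_green (P R : ℝ[X]) :
    expInt l (expLap l P * R) = expInt l (P * expLap l R)
      + (P.eval 0 * (expDeriv l R).eval 0 - (expDeriv l P).eval 0 * R.eval 0) := by
  have e1 : expLap l P * R = expDeriv l (expDeriv l P) * R - C (l ^ 2) * (P * R) := by
    rw [expLap_eq]; ring
  have e2 : P * expLap l R = expDeriv l (expDeriv l R) * P - C (l ^ 2) * (P * R) := by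
    rw [expLap_eq]; ring
  rw [e1, e2, expInt_sub hl, expInt_sub hl, expInt_parts hl, expInt_parts hl (expDeriv l R) P,
    mul_comm (expDeriv l P) (expDeriv l R)]
  ring

/-- One factor of the operator is moved from `P` to `R` at a time. The induction replaces `R` by
`expLap l R`, hence the quantifier over `R`. -/
theorem expInt_green_pow (P : ℝ[X]) (j : ℕ) : ∀ R : ℝ[X],
    expInt l ((expLap l ^ j) P * R) = expInt l (P * (expLap l ^ j) R)
      + ∑ k ∈ Finset.range j,
        (((expLap l ^ k) P).eval 0 * (expDeriv l ((expLap l ^ (j - 1 - k)) R)).eval 0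
          - (expDeriv l ((expLap l ^ k) P)).eval 0 * ((expLap l ^ (j - 1 - k)) R).eval 0) := by
  induction j with
  | zero => simp
  | succ j ih =>
    intro R
    rw [pow_succ', Module.End.mul_apply, expInt_green hl, ih, Finset.sum_range_succ,
      ← Module.End.mul_apply (expLap l ^ j), ← pow_succ, ← pow_succ']
    have : ∀ k ∈ Finset.range j,
        (((expLap l ^ k) P).eval 0 * (expDeriv l ((expLap l ^ (j - 1 - k)) (expLap l R))).eval 0
          - (expDeriv l ((expLap l ^ k) P)).eval 0
            * ((expLap l ^ (j - 1 - k)) (expLap l R)).eval 0)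
        = (((expLap l ^ k) P).eval 0 * (expDeriv l ((expLap l ^ (j + 1 - 1 - k)) R)).eval 0
          - (expDeriv l ((expLap l ^ k) P)).eval 0
            * ((expLap l ^ (j + 1 - 1 - k)) R).eval 0) := by
      intro k hk
      rw [← Module.End.mul_apply (expLap l ^ (j - 1 - k)) (expLap l), ← pow_succ,
        show j - 1 - k + 1 = j + 1 - 1 - k by have := Finset.mem_range.1 hk; omega]
    rw [Finset.sum_congr rfl this]
    simp
    ring

end

/-- The Dirichlet form of order `m` on functions `Q e^{-l y}`: `∫_0^∞ |∇^m (Q e^{-ly})|²`, where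
the tangential part of the gradient is multiplication by `l`. -/
noncomputable def expEnergy (l : ℝ) (m : ℕ) (P R : ℝ[X]) : ℝ :=
  if Even m then expInt l ((expLap l ^ (m / 2)) P * (expLap l ^ (m / 2)) R)
  else l ^ 2 * expInt l ((expLap l ^ (m / 2)) P * (expLap l ^ (m / 2)) R)
    + expInt l (expDeriv l ((expLap l ^ (m / 2)) P) * expDeriv l ((expLap l ^ (m / 2)) R))

theorem expEnergy_comm (l : ℝ) (m : ℕ) (P R : ℝ[X]) : expEnergy l m P R = expEnergy l m R P := by
  simp only [expEnergy, mul_comm]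

theorem expEnergy_add_left {l : ℝ} (hl : 0 < l) (m : ℕ) (P Q R : ℝ[X]) :
    expEnergy l m (P + Q) R = expEnergy l m P R + expEnergy l m Q R := by
  simp only [expEnergy, map_add, add_mul, expInt_add hl]
  split_ifs <;> ring

/-- Green's formula for the Dirichlet form, for `(∂_y² - l²)^m (R e^{-ly}) = 0`. -/
theorem expEnergy_eq_boundary {l : ℝ} (hl : 0 < l) {m : ℕ} {P R : ℝ[X]}
    (hR : (expLap l ^ m) R = 0)
    (hP : ∀ k, 2 * k + 2 ≤ m → (expDeriv l ((expLap l ^ k) P)).eval 0 = 0) :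
    expEnergy l m P R = (-1) ^ m * ∑ k ∈ Finset.range ((m + 1) / 2),
      ((expLap l ^ k) P).eval 0 * (expDeriv l ((expLap l ^ (m - 1 - k)) R)).eval 0 := by
  rcases Nat.even_or_odd' m with ⟨j, rfl | rfl⟩
  · have e : (expLap l ^ j) ((expLap l ^ j) R) = 0 := by
      rw [← Module.End.mul_apply, ← pow_add, ← two_mul, hR]
    have h0 : expInt l (P * 0) = 0 := by simp [expInt]
    rw [expEnergy, if_pos (by simp), Nat.mul_div_cancel_left _ two_pos, expInt_green_pow hl, e, h0,
      zero_add, show (2 * j + 1) / 2 = j by omega, pow_mul, neg_one_sq, one_pow, one_mul]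
    refine Finset.sum_congr rfl fun k hk => ?_
    have hk := Finset.mem_range.1 hk
    -- The vanishing normal derivatives of `P` remove one of the two boundary terms at each level.
    rw [hP k (by omega), ← Module.End.mul_apply (expLap l ^ (j - 1 - k)) (expLap l ^ j), ← pow_add,
      show j - 1 - k + j = 2 * j - 1 - k by omega]
    ring
  · have e : (expLap l ^ j) ((expLap l ^ (j + 1)) R) = 0 := by
      rw [← Module.End.mul_apply, ← pow_add, show j + (j + 1) = 2 * j + 1 by ring, hR]
    have h0 : expInt l (P * 0) = 0 := by simp [expInt]
    have h1 := expInt_green_pow hl P j ((expLap l ^ (j + 1)) R)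
    -- In odd order, one more integration by parts of the normal derivatives supplies the boundary
    -- term `k = j` and the overall sign. The `l ^ 2` part of the energy completes `∂_y²` to `∂_y² -
    -- l²`.
    have h2 := expInt_parts hl (expDeriv l ((expLap l ^ j) R)) ((expLap l ^ j) P)
    have h3 : (expLap l ^ j) P * (expLap l ^ (j + 1)) R
        = expDeriv l (expDeriv l ((expLap l ^ j) R)) * (expLap l ^ j) P
          - C (l ^ 2) * ((expLap l ^ j) P * (expLap l ^ j) R) := by
      rw [pow_succ', Module.End.mul_apply, expLap_eq]; ring
    rw [h3, expInt_sub hl, expInt_C_mul, e, h0, zero_add] at h1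
    rw [expEnergy, if_neg (by simp [parity_simps]), show (2 * j + 1) / 2 = j by omega,
      show (2 * j + 1 + 1) / 2 = j + 1 by omega, Finset.sum_range_succ,
      pow_succ (-1 : ℝ), pow_mul, neg_one_sq, one_pow, one_mul, show 2 * j + 1 - 1 - j = j by omega]
    have h4 : ∀ k ∈ Finset.range j,
        (((expLap l ^ k) P).eval 0
            * (expDeriv l ((expLap l ^ (j - 1 - k)) ((expLap l ^ (j + 1)) R))).eval 0
          - (expDeriv l ((expLap l ^ k) P)).eval 0
            * ((expLap l ^ (j - 1 - k)) ((expLap l ^ (j + 1)) R)).eval 0)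
        = ((expLap l ^ k) P).eval 0
            * (expDeriv l ((expLap l ^ (2 * j + 1 - 1 - k)) R)).eval 0 := by
      intro k hk
      have hk := Finset.mem_range.1 hk
      rw [hP k (by omega), ← Module.End.mul_apply (expLap l ^ (j - 1 - k)) (expLap l ^ (j + 1)),
        ← pow_add, show j - 1 - k + (j + 1) = 2 * j + 1 - 1 - k by omega]
      ring
    rw [Finset.sum_congr rfl h4] at h1
    rw [mul_comm (expDeriv l ((expLap l ^ j) P))]
    linarith

/-! ### The reverse Bessel polynomials and the energy of a single mode. -/

/-- The reverse Bessel polynomials, scaled by `l`: up to a constant, `θ_n(y) e^{-ly}` is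
`y^{n+1/2} K_{n+1/2}(ly)`. -/
noncomputable def revBessel (l : ℝ) : ℕ → ℝ[X]
  | 0 => 1
  | 1 => 1 + C l * X
  | n + 2 => C (2 * n + 3 : ℝ) * revBessel l (n + 1) + C (l ^ 2) * X ^ 2 * revBessel l n

theorem expDeriv_revBessel_zero (l : ℝ) : expDeriv l (revBessel l 0) = -C l := by
  simp [expDeriv_apply, revBessel]

/-- This is the classical `(z^ν K_ν)' = -z^ν K_{ν-1}` in polynomial form. Strong induction is needed
because the recursion reaches two indices back. -/
theorem expDeriv_revBessel_succ (l : ℝ) (n : ℕ) :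
    expDeriv l (revBessel l (n + 1)) = -(C (l ^ 2) * X * revBessel l n) := by
  induction n using Nat.strong_induction_on with
  | _ n ih =>
    match n with
    | 0 => simp [expDeriv_apply, revBessel]; ring
    | 1 =>
      simp only [expDeriv_apply, revBessel, derivative_add, derivative_mul, derivative_C,
        derivative_X_pow, derivative_X, derivative_one]
      simp only [C_add, C_mul, C_pow, C_ofNat, C_0, Nat.cast_zero, Nat.cast_ofNat]
      ring
    | n + 2 =>
      have h1 := ih (n + 1) (by omega)
      have h0 := ih n (by omega)
      rw [expDeriv_apply] at h0 h1 ⊢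
      have e1 : derivative (revBessel l (n + 2)) = _ := sub_eq_iff_eq_add.1 h1
      have e0 : derivative (revBessel l (n + 1)) = _ := sub_eq_iff_eq_add.1 h0
      rw [revBessel, derivative_add, derivative_mul, derivative_mul, derivative_mul, e1, e0]
      simp only [derivative_C, derivative_X_pow, revBessel]
      simp only [C_add, C_mul, C_pow, Nat.cast_add, Nat.cast_one, Nat.cast_ofNat, C_ofNat, C_1]
      ring

theorem expLap_revBessel_zero (l : ℝ) : expLap l (revBessel l 0) = 0 := by
  simp [expLap_apply, revBessel]

/-- The operator lowers the Bessel index by one up to a factor. This makes every power of it on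
`revBessel l n` explicit and forces the power `n + 1` to vanish. -/
theorem expLap_revBessel_succ (l : ℝ) (n : ℕ) :
    expLap l (revBessel l (n + 1)) = C (-2 * l ^ 2 * (n + 1)) * revBessel l n := by
  rw [expLap_eq, expDeriv_revBessel_succ]
  match n with
  | 0 =>
    simp only [expDeriv_apply, revBessel, derivative_mul, derivative_C, derivative_X,
      derivative_one, derivative_neg]
    simp only [C_add, C_mul, C_pow, C_neg, C_ofNat, C_0, C_1, Nat.cast_zero]
    ring
  | n + 1 =>
    have h0 := expDeriv_revBessel_succ l n
    rw [expDeriv_apply] at h0 ⊢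
    have e0 : derivative (revBessel l (n + 1)) = _ := sub_eq_iff_eq_add.1 h0
    rw [derivative_neg, derivative_mul, derivative_mul, e0]
    simp only [derivative_C, derivative_X, revBessel]
    simp only [C_add, C_mul, C_pow, C_neg, Nat.cast_add, Nat.cast_one, C_ofNat, C_1]
    ring

theorem expLap_pow_revBessel (l : ℝ) (k : ℕ) : ∀ n : ℕ, k ≤ n →
    (expLap l ^ k) (revBessel l n)
      = C ((-2 * l ^ 2) ^ k * n.descFactorial k) * revBessel l (n - k) := by
  induction k with
  | zero => simp
  | succ k ih =>
    intro n hn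
    obtain ⟨n, rfl⟩ := Nat.exists_eq_succ_of_ne_zero (show n ≠ 0 by omega)
    rw [pow_succ, Module.End.mul_apply, Nat.succ_eq_add_one, expLap_revBessel_succ, ← smul_eq_C_mul,
      map_smul, ih n (by omega), smul_eq_C_mul, ← mul_assoc, ← C_mul, Nat.succ_descFactorial_succ,
      Nat.add_sub_add_right]
    congr 2
    push_cast
    ring

theorem expLap_pow_succ_revBessel (l : ℝ) (n : ℕ) : (expLap l ^ (n + 1)) (revBessel l n) = 0 := by
  rw [pow_succ', Module.End.mul_apply, expLap_pow_revBessel l n n le_rfl, ← smul_eq_C_mul, map_smul,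
    Nat.sub_self, expLap_revBessel_zero, smul_zero]

theorem eval_zero_revBessel_succ (l : ℝ) (n : ℕ) :
    (revBessel l (n + 1)).eval 0 = (2 * n + 1) * (revBessel l n).eval 0 := by
  match n with
  | 0 => simp [revBessel]
  | n + 1 => rw [revBessel]; simp; left; ring

theorem eval_zero_revBessel (l : ℝ) (n : ℕ) :
    (revBessel l n).eval 0 = 2 ^ n * Real.Gamma (n + 1 / 2) / Real.Gamma (1 / 2) := by
  induction n with
  | zero => simp [revBessel, (Real.Gamma_pos_of_pos (show (0 : ℝ) < 2⁻¹ by norm_num)).ne']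
  | succ n ih =>
    rw [eval_zero_revBessel_succ, ih, show ((n + 1 : ℕ) : ℝ) + 1 / 2 = (n + 1 / 2 : ℝ) + 1 by
      push_cast; ring, Real.Gamma_add_one (by positivity)]
    ring

theorem eval_zero_revBessel_pos (l : ℝ) (n : ℕ) : 0 < (revBessel l n).eval 0 := by
  rw [eval_zero_revBessel]
  have := Real.Gamma_pos_of_pos (show (0 : ℝ) < 1 / 2 by norm_num)
  have := Real.Gamma_pos_of_pos (show (0 : ℝ) < n + 1 / 2 by positivity)
  positivity

/-- The source of the Gamma quotients in the boundary conditions. The falling factorial gives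
`Γ(m)/Γ(m-k)`, the ratio of the values at `0` gives `Γ(m-1/2-k)/Γ(m-1/2)`, and the powers of `2`
cancel. -/
theorem eval_zero_expLap_pow_revBessel (l : ℝ) {m k : ℕ} (hm : 1 ≤ m) (hk : k + 1 ≤ m) :
    ((expLap l ^ k) (revBessel l (m - 1))).eval 0
      = Real.Gamma m * Real.Gamma ((m : ℝ) - 1 / 2 - k) /
          (Real.Gamma ((m : ℝ) - k) * Real.Gamma ((m : ℝ) - 1 / 2)) * (-l ^ 2) ^ k
        * (revBessel l (m - 1)).eval 0 := by
  obtain ⟨n, rfl⟩ := Nat.exists_eq_add_of_le' hm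
  obtain ⟨i, rfl⟩ := Nat.exists_eq_add_of_le' (show k ≤ n by omega)
  rw [Nat.add_sub_cancel, expLap_pow_revBessel l k _ (by omega), eval_mul, eval_C,
    eval_zero_revBessel, eval_zero_revBessel, Nat.add_sub_cancel]
  have e1 : ((i + k + 1 : ℕ) : ℝ) - 1 / 2 - k = i + 1 / 2 := by push_cast; ring
  have e2 : ((i + k + 1 : ℕ) : ℝ) - k = (i : ℕ) + 1 := by push_cast; ring
  have e3 : ((i + k + 1 : ℕ) : ℝ) - 1 / 2 = (i + k : ℕ) + 1 / 2 := by push_cast; ring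
  have e4 : ((i + k + 1 : ℕ) : ℝ) = (i + k : ℕ) + 1 := by push_cast; ring
  rw [e1, e2, e3, e4, Real.Gamma_nat_eq_factorial, Real.Gamma_nat_eq_factorial]
  have h1 := (Real.Gamma_pos_of_pos (show (0 : ℝ) < 1 / 2 by norm_num)).ne'
  have h2 := (Real.Gamma_pos_of_pos (show (0 : ℝ) < (i + k : ℕ) + 1 / 2 by positivity)).ne'
  have h3 : ((i + k).factorial : ℝ) = i.factorial * (i + k).descFactorial k := by
    have := Nat.factorial_mul_descFactorial (show k ≤ i + k by omega)
    rw [Nat.add_sub_cancel] at this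
    exact_mod_cast this.symm
  rw [h3]
  field_simp
  rw [neg_pow (2 * l ^ 2), neg_pow (l ^ 2)]
  ring

/-- For `k < n` the index is still positive after `k` steps, and then the derivative carries a
factor `X`. -/
theorem eval_zero_expDeriv_expLap_pow_revBessel (l : ℝ) {n k : ℕ} (hk : k < n) :
    (expDeriv l ((expLap l ^ k) (revBessel l n))).eval 0 = 0 := by
  obtain ⟨i, hi⟩ := Nat.exists_eq_succ_of_ne_zero (show n - k ≠ 0 by omega)
  rw [expLap_pow_revBessel l k n hk.le, hi, ← smul_eq_C_mul, map_smul, Nat.succ_eq_add_one,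
    expDeriv_revBessel_succ]
  simp

/-- In the boundary sum the `k`-th term contains the normal derivative at level `m - 1 - k`, which
is zero unless `k = 0`. There the bottom of the chain, `e^{-ly}`, contributes the odd power of `l`.
-/
theorem expEnergy_revBessel {l : ℝ} (hl : 0 < l) {m : ℕ} (hm : 1 ≤ m) :
    expEnergy l m (revBessel l (m - 1)) (revBessel l (m - 1))
      = Real.Gamma m * Real.Gamma (1 / 2) / Real.Gamma ((m : ℝ) - 1 / 2) * l ^ (2 * m - 1)
        * (revBessel l (m - 1)).eval 0 ^ 2 := by
  obtain ⟨n, rfl⟩ := Nat.exists_eq_add_of_le' hm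
  simp only [Nat.add_sub_cancel]
  rw [expEnergy_eq_boundary hl (expLap_pow_succ_revBessel l n)
    (fun k hk => eval_zero_expDeriv_expLap_pow_revBessel l (by omega)),
    Finset.sum_eq_single_of_mem 0 (by simp)]
  · rw [pow_zero, Module.End.one_apply, Nat.add_sub_cancel, Nat.sub_zero,
      expLap_pow_revBessel l n n le_rfl, Nat.sub_self, ← smul_eq_C_mul, map_smul,
      expDeriv_revBessel_zero, eval_zero_revBessel, Nat.descFactorial_self]
    have e3 : ((n + 1 : ℕ) : ℝ) - 1 / 2 = n + 1 / 2 := by push_cast; ring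
    have h1 := (Real.Gamma_pos_of_pos (show (0 : ℝ) < 1 / 2 by norm_num)).ne'
    have h2 := (Real.Gamma_pos_of_pos (show (0 : ℝ) < n + 1 / 2 by positivity)).ne'
    rw [e3, show ((n + 1 : ℕ) : ℝ) = (n : ℕ) + 1 by push_cast; ring, Real.Gamma_nat_eq_factorial]
    simp only [eval_smul, eval_neg, eval_C, smul_eq_mul]
    rw [show 2 * (n + 1) - 1 = 2 * n + 1 by omega, pow_succ l (2 * n), pow_mul, neg_mul,
      neg_pow (2 * l ^ 2), pow_succ (-1 : ℝ)]
    have : (-1 : ℝ) ^ n * (-1) ^ n = 1 := by rw [← mul_pow]; norm_num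
    field_simp
    linear_combination (l ^ 2) ^ n * 2 ^ n * this
  · intro k hk hk0
    have := Finset.mem_range.1 hk
    rw [eval_zero_expDeriv_expLap_pow_revBessel l (by omega), mul_zero]

/-- The energy of the solution of the boundary value problem for `(∂_y² - l²)^m`. -/
theorem expEnergy_of_boundary {l : ℝ} (hl : 0 < l) {m : ℕ} (hm : 1 ≤ m) {Q : ℝ[X]}
    (hQ : Q.natDegree < m) (a : ℝ)
    (h1 : ∀ k, 2 * k + 1 ≤ m → ((expLap l ^ k) Q).eval 0
      = Real.Gamma m * Real.Gamma ((m : ℝ) - 1 / 2 - k) /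
          (Real.Gamma ((m : ℝ) - k) * Real.Gamma ((m : ℝ) - 1 / 2)) * (-l ^ 2) ^ k * a)
    (h2 : ∀ k, 2 * k + 2 ≤ m → (expDeriv l ((expLap l ^ k) Q)).eval 0 = 0) :
    expEnergy l m Q Q
      = Real.Gamma m * Real.Gamma (1 / 2) / Real.Gamma ((m : ℝ) - 1 / 2) * l ^ (2 * m - 1)
        * a ^ 2 := by
  set e := (revBessel l (m - 1)).eval 0 with he
  have he0 : e ≠ 0 := (eval_zero_revBessel_pos l (m - 1)).ne'
  -- The model solution is normalised to have value `a` at `0`.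
  set p := (a / e) • revBessel l (m - 1) with hp
  have hpm : (expLap l ^ m) p = 0 := by
    have := expLap_pow_succ_revBessel l (m - 1)
    rw [Nat.sub_add_cancel hm] at this
    rw [hp, map_smul, this, smul_zero]
  have hr1 : ∀ k, 2 * k + 1 ≤ m → ((expLap l ^ k) (Q - p)).eval 0 = 0 := by
    intro k hk
    rw [map_sub, eval_sub, h1 k hk, hp, map_smul, eval_smul,
      eval_zero_expLap_pow_revBessel l hm (by omega), ← he, smul_eq_mul]
    field_simp
    ring
  have hr2 : ∀ k, 2 * k + 2 ≤ m → (expDeriv l ((expLap l ^ k) (Q - p))).eval 0 = 0 := by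
    intro k hk
    rw [map_sub, map_sub, eval_sub, h2 k hk, hp, map_smul, map_smul, eval_smul,
      eval_zero_expDeriv_expLap_pow_revBessel l (by omega), smul_zero, sub_zero]
  -- Zero boundary data make `Q - p` orthogonal to all solutions. Applied to `Q` and to `p` this
  -- equates their energies, with no need for `Q = p`.
  have hr : ∀ R, (expLap l ^ m) R = 0 → expEnergy l m (Q - p) R = 0 := by
    intro R hR
    rw [expEnergy_eq_boundary hl hR hr2, Finset.sum_eq_zero, mul_zero]
    intro k hk
    have := Finset.mem_range.1 hk
    rw [hr1 k (by omega), zero_mul]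
  have hQm := expLap_pow_eq_zero l hQ
  have s1 : expEnergy l m Q Q = expEnergy l m p Q := by
    have := expEnergy_add_left hl m (Q - p) p Q
    rwa [sub_add_cancel, hr Q hQm, zero_add] at this
  have s2 : expEnergy l m p Q = expEnergy l m p p := by
    have := expEnergy_add_left hl m (Q - p) p p
    rwa [sub_add_cancel, hr p hpm, zero_add, expEnergy_comm] at this
  have s3 : expEnergy l m p p = (a / e) ^ 2 *
      expEnergy l m (revBessel l (m - 1)) (revBessel l (m - 1)) := by
    simp only [expEnergy, hp, map_smul]
    simp only [smul_eq_C_mul]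
    have : ∀ P R : ℝ[X], expInt l (C (a / e) * P * (C (a / e) * R))
        = (a / e) ^ 2 * expInt l (P * R) := by
      intro P R
      rw [← expInt_C_mul]
      congr 1
      rw [C_pow]; ring
    simp only [this]
    split_ifs <;> ring
  rw [s1, s2, s3, expEnergy_revBessel hl hm, ← he]
  field_simp

end HalfSpace

/-! ### Weak `L²` solutions of `(∂_y² - l²)^m w = 0` on the half line. -/

namespace HalfSpace

open Polynomial Set
open scoped SchwartzMap ContDiff

/-- The test functions `C_c^∞(0, ∞)`, as a space of Schwartz functions on `ℝ`. -/
def halfLineTest : Submodule ℝ 𝓢(ℝ, ℝ) where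
  carrier := {χ | HasCompactSupport χ ∧ tsupport χ ⊆ Ioi 0}
  add_mem' {χ ψ} h1 h2 :=
    ⟨h1.1.add h2.1, (tsupport_add (χ : ℝ → ℝ) ψ).trans (union_subset h1.2 h2.2)⟩
  zero_mem' := by
    have : tsupport ((0 : 𝓢(ℝ, ℝ)) : ℝ → ℝ) = ∅ := by
      rw [tsupport_eq_empty_iff]; ext; simp
    exact ⟨by rw [HasCompactSupport, this]; exact isCompact_empty, by rw [this]; simp⟩
  smul_mem' c {χ} h := by
    have : tsupport ((c • χ : 𝓢(ℝ, ℝ)) : ℝ → ℝ) ⊆ tsupport χ :=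
      closure_mono (Function.support_const_smul_subset c (χ : ℝ → ℝ))
    exact ⟨h.1.mono' (subset_tsupport _ |>.trans this), this.trans h.2⟩

theorem derivCLM_mem_halfLineTest {χ : 𝓢(ℝ, ℝ)} (h : χ ∈ halfLineTest) :
    SchwartzMap.derivCLM ℝ ℝ χ ∈ halfLineTest := by
  have h1 := SchwartzMap.tsupport_derivCLM_subset (𝕜 := ℝ) χ
  exact ⟨h.1.mono' (subset_tsupport _ |>.trans h1), h1.trans h.2⟩

/-- The operator `∂_y - a`. -/
noncomputable def modeShift (a : ℝ) : 𝓢(ℝ, ℝ) →L[ℝ] 𝓢(ℝ, ℝ) :=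
  SchwartzMap.derivCLM ℝ ℝ - a • ContinuousLinearMap.id ℝ _

/-- The operator `∂_y² - l²`. -/
noncomputable def modeLap (l : ℝ) : 𝓢(ℝ, ℝ) →L[ℝ] 𝓢(ℝ, ℝ) :=
  SchwartzMap.derivCLM ℝ ℝ ∘L SchwartzMap.derivCLM ℝ ℝ - (l ^ 2) • ContinuousLinearMap.id ℝ _

theorem modeShift_def (a : ℝ) (χ : 𝓢(ℝ, ℝ)) :
    modeShift a χ = SchwartzMap.derivCLM ℝ ℝ χ - a • χ := by
  simp [modeShift]

theorem modeLap_def (l : ℝ) (χ : 𝓢(ℝ, ℝ)) :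
    modeLap l χ = SchwartzMap.derivCLM ℝ ℝ (SchwartzMap.derivCLM ℝ ℝ χ) - (l ^ 2) • χ := by
  simp [modeLap]

/-- The factorisation `(∂ - l)(∂ + l)` reduces solvability to first-order equations. -/
theorem modeLap_eq_modeShift (l : ℝ) (χ : 𝓢(ℝ, ℝ)) :
    modeLap l χ = modeShift l (modeShift (-l) χ) := by
  rw [modeLap_def, modeShift_def, modeShift_def, map_sub, map_smul]
  module

theorem modeShift_mem (a : ℝ) {χ : 𝓢(ℝ, ℝ)} (h : χ ∈ halfLineTest) :
    modeShift a χ ∈ halfLineTest := by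
  rw [modeShift_def]
  exact sub_mem (derivCLM_mem_halfLineTest h) (halfLineTest.smul_mem _ h)

theorem modeLap_mem (l : ℝ) {χ : 𝓢(ℝ, ℝ)} (h : χ ∈ halfLineTest) : modeLap l χ ∈ halfLineTest := by
  rw [modeLap_eq_modeShift]
  exact modeShift_mem _ (modeShift_mem _ h)

theorem integral_mul_modeShift (a : ℝ) {χ : 𝓢(ℝ, ℝ)} (hχ : HasCompactSupport χ) {f f' : ℝ → ℝ}
    (hf : ∀ t, HasDerivAt f (f' t) t) (hf' : Continuous f') :
    ∫ t, modeShift a χ t * f t = -∫ t, χ t * (f' t + a * f t) := by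
  have hfc : Continuous f := continuous_iff_continuousAt.2 fun t => (hf t).continuousAt
  have hd : HasCompactSupport (SchwartzMap.derivCLM ℝ ℝ χ) :=
    hχ.mono' ((subset_tsupport _).trans (SchwartzMap.tsupport_derivCLM_subset (𝕜 := ℝ) χ))
  have i1 : Integrable fun t => SchwartzMap.derivCLM ℝ ℝ χ t * f t :=
    (by fun_prop : Continuous _).integrable_of_hasCompactSupport hd.mul_right
  have i2 : ∀ {g : ℝ → ℝ}, Continuous g → Integrable fun t => χ t * g t := fun hg =>
    (by fun_prop : Continuous _).integrable_of_hasCompactSupport hχ.mul_right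
  have h0 := integral_eq_zero_of_hasDerivAt_of_integrable (f := fun t => χ t * f t)
    (fun t => (χ.hasDerivAt t).mul (hf t)) (i1.add (i2 hf')) (i2 hfc)
  have e1 : ∫ t, modeShift a χ t * f t
      = (∫ t, SchwartzMap.derivCLM ℝ ℝ χ t * f t) - ∫ t, χ t * (a * f t) := by
    rw [← integral_sub i1 (i2 (by fun_prop))]
    refine integral_congr_ae (.of_forall fun t => ?_)
    simp only [modeShift_def, sub_apply, smul_apply, smul_eq_mul]
    ring
  have e2 : ∫ t, χ t * (f' t + a * f t) = (∫ t, χ t * f' t) + ∫ t, χ t * (a * f t) := by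
    rw [← integral_add (i2 hf') (i2 (by fun_prop))]
    simp only [mul_add]
  have h1 := integral_add i1 (i2 hf')
  have h2 := h1.symm.trans h0
  linarith

/-- The `i`-th moment of a test function with weight `e^{-a t}`. -/
noncomputable def expMoment (a : ℝ) (i : ℕ) (χ : 𝓢(ℝ, ℝ)) : ℝ :=
  ∫ t, χ t * (t ^ i * Real.exp (-a * t))

/-- At `i = 0` the truncated index `i - 1` is harmless, since its coefficient is `0`. -/
theorem expMoment_modeShift (a b : ℝ) (i : ℕ) {χ : 𝓢(ℝ, ℝ)} (hχ : HasCompactSupport χ) :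
    expMoment b i (modeShift a χ) = (b - a) * expMoment b i χ - i * expMoment b (i - 1) χ := by
  have hf : ∀ t : ℝ, HasDerivAt (fun t => t ^ i * Real.exp (-b * t))
      (i * t ^ (i - 1) * Real.exp (-b * t) + t ^ i * (Real.exp (-b * t) * -b)) t := by
    intro t
    exact (hasDerivAt_pow i t).mul ((((hasDerivAt_id t).const_mul (-b)).exp).congr_deriv (by simp))
  have i2 : ∀ {g : ℝ → ℝ}, Continuous g → Integrable fun t => χ t * g t := fun hg =>
    (by fun_prop : Continuous _).integrable_of_hasCompactSupport hχ.mul_right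
  rw [expMoment, integral_mul_modeShift a hχ hf (by fun_prop), expMoment, expMoment,
    ← integral_const_mul, ← integral_const_mul, ← integral_sub ((i2 (by fun_prop)).const_mul _)
      ((i2 (by fun_prop)).const_mul _), ← integral_neg]
  refine integral_congr_ae (.of_forall fun t => ?_)
  ring

/-- Variation of constants gives `θ = e^{at} ∫_0^t e^{-as} χ(s) ds`. The moment condition is what
makes `θ` vanish beyond the support of `χ`. -/
theorem exists_modeShift_eq (a : ℝ) {χ : 𝓢(ℝ, ℝ)} (hχ : χ ∈ halfLineTest)
    (h0 : expMoment a 0 χ = 0) : ∃ θ ∈ halfLineTest, modeShift a θ = χ := by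
  set g : ℝ → ℝ := fun t => Real.exp (-a * t) * χ t with hg
  have hgc : Continuous g := by fun_prop
  have hgs : ContDiff ℝ ∞ g := (by fun_prop : ContDiff ℝ ∞ fun t : ℝ => Real.exp (-a * t)).mul
    (χ.smooth ⊤)
  set G : ℝ → ℝ := fun t => ∫ s in (0 : ℝ)..t, g s with hG
  have hGd : ∀ t, HasDerivAt G (g t) t := fun t =>
    intervalIntegral.integral_hasDerivAt_right (hgc.intervalIntegrable _ _)
      (hgc.stronglyMeasurableAtFilter _ _) hgc.continuousAt
  have hGs : ContDiff ℝ ∞ G := by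
    rw [contDiff_infty_iff_deriv]
    exact ⟨fun t => (hGd t).differentiableAt, by rwa [funext fun t => (hGd t).deriv]⟩
  obtain ⟨α, hα, β, hαβ⟩ : ∃ α > 0, ∃ β, tsupport χ ⊆ Icc α β := by
    rcases (tsupport χ).eq_empty_or_nonempty with he | hne
    · exact ⟨1, one_pos, 1, by simp [he]⟩
    · obtain ⟨α, hα⟩ := (show IsCompact (tsupport χ) from hχ.1).exists_isLeast hne
      obtain ⟨β, hβ⟩ := (show IsCompact (tsupport χ) from hχ.1).bddAbove
      exact ⟨α, hχ.2 hα.1, β, fun x hx => ⟨hα.2 hx, hβ hx⟩⟩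
  have hg0 : ∀ t, t ∉ Icc α β → g t = 0 := fun t ht => by
    simp [hg, image_eq_zero_of_notMem_tsupport fun h => ht (hαβ h)]
  have hG0 : ∀ t, t ∉ Icc α β → G t = 0 := by
    intro t ht
    rcases lt_or_ge t α with h | h
    · refine intervalIntegral.integral_zero_ae (.of_forall fun s hs => hg0 s fun hs' => ?_)
      rcases le_total 0 t with h' | h'
      · rw [uIoc_of_le h'] at hs; linarith [hs.2, hs'.1]
      · rw [uIoc_of_ge h'] at hs; linarith [hs.2, hs'.1]
    · have hβ : β < t := not_le.1 fun h2 => ht ⟨h, h2⟩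
      have h1 : ∫ s in Ioc 0 t, g s = ∫ s, g s :=
        setIntegral_eq_integral_of_forall_compl_eq_zero fun s hs => hg0 s fun hs' =>
          hs ⟨lt_of_lt_of_le hα hs'.1, hs'.2.trans hβ.le⟩
      have h2 : ∫ s, g s = 0 := by
        rw [← h0, expMoment]
        simp [hg, mul_comm]
      simp only [hG]
      rw [intervalIntegral.integral_of_le (hα.le.trans h), h1, h2]
  set θ : ℝ → ℝ := fun t => Real.exp (a * t) * G t with hθ
  have hθs : ContDiff ℝ ∞ θ :=
    (by fun_prop : ContDiff ℝ ∞ fun t : ℝ => Real.exp (a * t)).mul hGs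
  have hsub : tsupport θ ⊆ Icc α β := by
    refine closure_minimal (fun t ht => ?_) isClosed_Icc
    by_contra h
    exact ht (by simp [hθ, hG0 t h])
  have hcs : HasCompactSupport θ := isCompact_Icc.of_isClosed_subset (isClosed_tsupport _) hsub
  refine ⟨hcs.toSchwartzMap hθs, ⟨hcs, fun t ht => hα.trans_le (hsub ht).1⟩, ?_⟩
  ext t
  have hd : HasDerivAt θ (Real.exp (a * t) * a * G t + Real.exp (a * t) * g t) t :=
    ((((hasDerivAt_id t).const_mul a).exp).congr_deriv (by simp)).mul (hGd t)
  have : Real.exp (a * t) * Real.exp (-a * t) = 1 := by rw [← Real.exp_add]; simp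
  simp only [modeShift_def, sub_apply, smul_apply,
    SchwartzMap.derivCLM_apply, smul_eq_mul]
  change deriv θ t - a * θ t = χ t
  rw [hd.deriv]
  simp only [hθ, hg]
  linear_combination χ t * this

/-- At the resonant weight, moment `i + 1` of the image is a nonzero multiple of moment `i` of `χ`,
so one vanishing moment is lost. -/
theorem expMoment_eq_zero_of_modeShift_self {a : ℝ} {n : ℕ} {χ : 𝓢(ℝ, ℝ)}
    (hχ : HasCompactSupport χ) (h : ∀ i < n + 1, expMoment a i (modeShift a χ) = 0) :
    ∀ i < n, expMoment a i χ = 0 := by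
  intro i hi
  have := h (i + 1) (by omega)
  rw [expMoment_modeShift a a _ hχ, sub_self, zero_mul, zero_sub, neg_eq_zero,
    Nat.add_sub_cancel] at this
  exact (mul_eq_zero.1 this).resolve_left (by positivity)

/-- Away from resonance the moments are related by a triangular system with diagonal entry `b - a ≠
0`, so none is lost. -/
theorem expMoment_eq_zero_of_modeShift_ne {a b : ℝ} (hab : a ≠ b) {n : ℕ} {χ : 𝓢(ℝ, ℝ)}
    (hχ : HasCompactSupport χ) (h : ∀ i < n, expMoment b i (modeShift a χ) = 0) :
    ∀ i < n, expMoment b i χ = 0 := by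
  intro i
  induction i with
  | zero =>
    intro hi
    have := h 0 hi
    rw [expMoment_modeShift a b _ hχ, Nat.cast_zero, zero_mul, sub_zero] at this
    exact (mul_eq_zero.1 this).resolve_left (sub_ne_zero.2 hab.symm)
  | succ i ih =>
    intro hi
    have := h (i + 1) hi
    rw [expMoment_modeShift a b _ hχ, Nat.add_sub_cancel, ih (by omega), mul_zero, sub_zero] at this
    exact (mul_eq_zero.1 this).resolve_left (sub_ne_zero.2 hab.symm)

/-- The range of the operator on test functions is cut out by the `2m` functions `t^i e^{±lt}` of
its kernel. Inverting the two first-order factors uses up one moment of each weight, so `m` of each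
suffice. -/
theorem exists_modeLap_iterate_eq {l : ℝ} (hl : l ≠ 0) (m : ℕ) : ∀ {χ : 𝓢(ℝ, ℝ)},
    χ ∈ halfLineTest → (∀ i < m, expMoment l i χ = 0) → (∀ i < m, expMoment (-l) i χ = 0) →
    ∃ θ ∈ halfLineTest, (modeLap l)^[m] θ = χ := by
  have hne : l ≠ -l := fun h => hl (by linarith)
  induction m with
  | zero => intro χ h _ _; exact ⟨χ, h, rfl⟩
  | succ m ih =>
    intro χ h h1 h2
    obtain ⟨θ₁, ht1, rfl⟩ := exists_modeShift_eq l h (h1 0 (by omega))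
    have m1 := expMoment_eq_zero_of_modeShift_self ht1.1 h1
    have m2 := expMoment_eq_zero_of_modeShift_ne hne ht1.1 h2
    obtain ⟨θ₂, ht2, rfl⟩ := exists_modeShift_eq (-l) ht1 (m2 0 (by omega))
    obtain ⟨θ, ht, rfl⟩ := ih ht2 (expMoment_eq_zero_of_modeShift_ne hne.symm ht2.1 m1)
      (expMoment_eq_zero_of_modeShift_self ht2.1 m2)
    exact ⟨θ, ht, by rw [Function.iterate_succ_apply', modeLap_eq_modeShift]⟩

theorem integrable_smul_of_tsupport_subset {X G : Type*} [TopologicalSpace X] [MeasurableSpace X]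
    [OpensMeasurableSpace X] [T2Space X] {μ : Measure X} [NormedAddCommGroup G] [NormedSpace ℝ G]
    {U : Set X} {f : X → G} (hf : LocallyIntegrableOn f U μ) {g : X → ℝ} (hg : Continuous g)
    (hc : HasCompactSupport g) (ht : tsupport g ⊆ U) : Integrable (fun x => g x • f x) μ := by
  have h1 : IntegrableOn f (tsupport g) μ := hf.integrableOn_compact_subset ht hc
  have h2 : IntegrableOn (fun x => g x • f x) (tsupport g) μ :=
    h1.continuousOn_smul hg.continuousOn hc
  refine (integrableOn_iff_integrable_of_support_subset fun x hx => ?_).1 h2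
  exact subset_tsupport g fun h => hx (by simp [h])

theorem integrable_schwartz_mul_memLp (χ : 𝓢(ℝ, ℝ)) {w : ℝ → ℝ}
    (hw : MemLp w 2 (volume.restrict (Ioi 0))) :
    Integrable (fun t => χ t * w t) (volume.restrict (Ioi 0)) :=
  ((χ.memLp 2 volume).restrict (Ioi 0)).integrable_mul hw

theorem setIntegral_test_mul {χ : 𝓢(ℝ, ℝ)} (hχ : χ ∈ halfLineTest) (u : ℝ → ℝ) :
    ∫ t in Ioi 0, χ t * u t = ∫ t, χ t * u t :=
  setIntegral_eq_integral_of_forall_compl_eq_zero fun t h0 => by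
    rw [image_eq_zero_of_notMem_tsupport fun h => h0 (hχ.2 h), zero_mul]

theorem ae_eq_of_forall_halfLineTest {f g : ℝ → ℝ}
    (hf : LocallyIntegrableOn f (Ioi 0)) (hg : LocallyIntegrableOn g (Ioi 0))
    (h : ∀ χ ∈ halfLineTest, ∫ t in Ioi 0, χ t * f t = ∫ t in Ioi 0, χ t * g t) :
    f =ᵐ[volume.restrict (Ioi 0)] g := by
  have := isOpen_Ioi.ae_eq_zero_of_integral_contDiff_smul_eq_zero (hf.sub hg) fun χ hs hc ht => by
    have hm : hc.toSchwartzMap hs ∈ halfLineTest := ⟨hc, ht⟩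
    have hχ : ∫ t, χ t * f t = ∫ t, χ t * g t :=
      ((setIntegral_test_mul hm f).symm.trans (h _ hm)).trans (setIntegral_test_mul hm g)
    have h1 := integral_sub (integrable_smul_of_tsupport_subset hf hs.continuous hc ht)
      (integrable_smul_of_tsupport_subset hg hs.continuous hc ht)
    simp only [Pi.sub_apply, smul_sub]
    exact h1.trans (sub_eq_zero.2 hχ)
  rw [Filter.EventuallyEq, ae_restrict_iff' measurableSet_Ioi]
  filter_upwards [this] with t ht h0
  exact sub_eq_zero.1 (ht h0)

theorem locallyIntegrableOn_of_memLp {f : ℝ → ℝ} (hf : MemLp f 2 (volume.restrict (Ioi 0))) :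
    LocallyIntegrableOn f (Ioi (0 : ℝ)) :=
  locallyIntegrableOn_of_locallyIntegrable_restrict (hf.locallyIntegrable (by norm_num))

/-- If `R ≠ 0`, then `|y R(y)|` tends to infinity, the factor `y` covering constant `R`. Since
`e^{ly} ≥ ly`, the function is eventually at least `1` in modulus, hence not in `L²`. -/
theorem eq_zero_of_memLp_poly_mul_exp {l : ℝ} (hl : 0 < l) {R : ℝ[X]}
    (hR : MemLp (fun y => R.eval y * Real.exp (l * y)) 2 (volume.restrict (Ioi 0))) : R = 0 := by
  by_contra h0
  have h1 : Filter.Tendsto (fun y : ℝ => |(X * R).eval y|) Filter.atTop Filter.atTop :=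
    Polynomial.abs_tendsto_atTop _ (by
      rw [← natDegree_pos_iff_degree_pos, natDegree_X_mul h0]
      exact Nat.succ_pos _)
  obtain ⟨N, hN⟩ := Filter.eventually_atTop.1 (h1.eventually_ge_atTop (1 / l))
  have h2 := hR.integrable_sq
  have h3 : IntegrableOn (fun _ : ℝ => (1 : ℝ)) (Ioi (max N 0)) := by
    refine Integrable.mono' (IntegrableOn.mono_set h2 (Ioi_subset_Ioi (le_max_right N 0)))
      (by fun_prop) ?_
    rw [ae_restrict_iff' measurableSet_Ioi]
    refine .of_forall fun y hy => ?_
    have hy' : max N 0 < y := hy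
    have hy0 : 0 < y := (le_max_right N 0).trans_lt hy'
    have h4 := hN y ((le_max_left N 0).trans hy'.le)
    rw [eval_mul, eval_X, abs_mul, abs_of_pos hy0] at h4
    have h5 : l * y ≤ Real.exp (l * y) := by linarith [Real.add_one_le_exp (l * y)]
    have h6 : 1 ≤ |R.eval y * Real.exp (l * y)| := by
      rw [abs_mul, abs_of_pos (Real.exp_pos _)]
      calc 1 = l * (1 / l) := by field_simp
        _ ≤ l * (y * |R.eval y|) := by gcongr
        _ = |R.eval y| * (l * y) := by ring
        _ ≤ _ := by gcongr
    rw [norm_one, ← sq_abs]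
    exact one_le_pow₀ h6
  rw [integrableOn_const_iff (by simp)] at h3
  simp at h3

theorem memLp_poly_mul_exp_neg {l : ℝ} (hl : 0 < l) (Q : ℝ[X]) :
    MemLp (fun y => Q.eval y * Real.exp (-l * y)) 2 (volume.restrict (Ioi 0)) := by
  rw [memLp_two_iff_integrable_sq (by fun_prop)]
  refine (integrableOn_poly_mul_exp (Q ^ 2) (b := 2 * l) (by positivity)).congr
    (.of_forall fun y => ?_)
  simp only [eval_pow]
  rw [mul_pow, ← Real.exp_nat_mul]
  congr 2
  push_cast
  ring

/-- `L²` solutions of `(∂_y² - l²)^m w = 0` on the half line are polynomials times `e^{-ly}`. -/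
theorem exists_poly_of_weak_modeLap {l : ℝ} (hl : 0 < l) {m : ℕ} (hm : 1 ≤ m) {w : ℝ → ℝ}
    (hw : MemLp w 2 (volume.restrict (Ioi 0)))
    (h : ∀ χ ∈ halfLineTest, ∫ t in Ioi 0, ((modeLap l)^[m] χ) t * w t = 0) :
    ∃ Q : ℝ[X], Q.natDegree < m ∧
      w =ᵐ[volume.restrict (Ioi 0)] fun y => Q.eval y * Real.exp (-l * y) := by
  have hmom : ∀ a i, ∃ L : halfLineTest →ₗ[ℝ] ℝ, ∀ χ, L χ = expMoment a i χ := by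
    intro a i
    refine ⟨⟨⟨fun χ => expMoment a i χ, fun χ ψ => ?_⟩, fun c χ => ?_⟩, fun χ => rfl⟩
    · have i2 : ∀ χ : halfLineTest,
          Integrable fun t => (χ : 𝓢(ℝ, ℝ)) t * (t ^ i * Real.exp (-a * t)) := fun χ =>
        (by fun_prop : Continuous _).integrable_of_hasCompactSupport χ.2.1.mul_right
      simp only [expMoment]
      rw [← integral_add (i2 χ) (i2 ψ)]
      simp [add_mul]
    · simp only [expMoment]
      rw [RingHom.id_apply, smul_eq_mul, ← integral_const_mul]
      simp [mul_assoc]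
  choose M hM using hmom
  obtain ⟨K, hK⟩ : ∃ K : halfLineTest →ₗ[ℝ] ℝ, ∀ χ, K χ = ∫ t in Ioi 0, (χ : 𝓢(ℝ, ℝ)) t * w t := by
    refine ⟨⟨⟨fun χ => ∫ t in Ioi 0, (χ : 𝓢(ℝ, ℝ)) t * w t, fun χ ψ => ?_⟩, fun c χ => ?_⟩,
      fun χ => rfl⟩
    · rw [← integral_add (integrable_schwartz_mul_memLp χ hw) (integrable_schwartz_mul_memLp ψ hw)]
      simp [add_mul]
    · rw [RingHom.id_apply, smul_eq_mul, ← integral_const_mul]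
      simp [mul_assoc]
  -- A test function with all `2m` moments zero lies in the range of the operator, where pairing
  -- with `w` gives `0`. By finite-dimensional duality this pairing is a combination of the moments,
  -- so `w` is a combination of the `t^i e^{±lt}`.
  have hspan := mem_span_of_iInf_ker_le_ker
    (L := (Sum.elim (fun i : Fin m => M l i) (fun i : Fin m => M (-l) i))) (K := K) (by
      intro χ hχ
      simp only [Submodule.mem_iInf, LinearMap.mem_ker, Sum.forall, Sum.elim_inl, Sum.elim_inr,
        hM] at hχ
      obtain ⟨θ, ht, he⟩ := exists_modeLap_iterate_eq hl.ne' m χ.2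
        (fun i hi => hχ.1 ⟨i, hi⟩) (fun i hi => hχ.2 ⟨i, hi⟩)
      rw [LinearMap.mem_ker, hK, ← he, h θ ht])
  obtain ⟨c, hc⟩ := (Submodule.mem_span_range_iff_exists_fun ℝ).1 hspan
  rw [Fintype.sum_sum_type] at hc
  simp only [Sum.elim_inl, Sum.elim_inr] at hc
  set Q : ℝ[X] := ∑ i : Fin m, C (c (Sum.inl i)) * X ^ (i : ℕ) with hQ
  set R : ℝ[X] := ∑ i : Fin m, C (c (Sum.inr i)) * X ^ (i : ℕ) with hR
  set g : ℝ → ℝ := fun y => Q.eval y * Real.exp (-l * y) + R.eval y * Real.exp (l * y) with hg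
  have hgc : Continuous g := by fun_prop
  have hwg : w =ᵐ[volume.restrict (Ioi 0)] g := by
    refine ae_eq_of_forall_halfLineTest (locallyIntegrableOn_of_memLp hw)
      (hgc.locallyIntegrable.locallyIntegrableOn _) fun χ hχ => ?_
    have i2 : ∀ a (i : ℕ), Integrable fun t => χ t * (t ^ i * Real.exp (-a * t)) := fun a i =>
      (by fun_prop : Continuous _).integrable_of_hasCompactSupport hχ.1.mul_right
    have := LinearMap.congr_fun hc ⟨χ, hχ⟩
    rw [hK] at this
    rw [← this, setIntegral_test_mul hχ]
    simp only [LinearMap.add_apply, LinearMap.sum_apply, LinearMap.smul_apply, hM, smul_eq_mul,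
      expMoment]
    simp_rw [← integral_const_mul]
    rw [← integral_finsetSum _ fun i _ => (i2 _ _).const_mul _,
      ← integral_finsetSum _ fun i _ => (i2 _ _).const_mul _,
      ← integral_add (integrable_finsetSum _ fun i _ => (i2 _ _).const_mul _)
        (integrable_finsetSum _ fun i _ => (i2 _ _).const_mul _)]
    refine integral_congr_ae (.of_forall fun t => ?_)
    simp only [hg, hQ, hR, eval_finsetSum, eval_mul, eval_C, eval_pow, eval_X, Finset.sum_mul,
      mul_add, Finset.mul_sum, neg_neg]
    congr 1 <;> exact Finset.sum_congr rfl fun i _ => by ring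
  -- Subtracting the decaying part leaves the growing one in `L²`, hence zero.
  have hR0 : R = 0 := by
    refine eq_zero_of_memLp_poly_mul_exp hl ((hw.sub (memLp_poly_mul_exp_neg hl Q)).ae_eq ?_)
    filter_upwards [hwg] with y hy
    simp [hy, hg]
  refine ⟨Q, ?_, hwg.trans (.of_forall fun y => by simp [hg, hR0])⟩
  refine lt_of_le_of_lt (natDegree_sum_le_of_forall_le _ (n := m - 1) _ fun i _ => ?_) (by omega)
  exact (natDegree_C_mul_X_pow_le _ _).trans (by have := i.2; omega)

end HalfSpace

/-! ### Traces and the energy identity on the half line. -/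

namespace HalfSpace

open Polynomial Set
open scoped SchwartzMap ContDiff

theorem hasDerivAt_poly_mul_exp (l : ℝ) (Q : ℝ[X]) (t : ℝ) :
    HasDerivAt (fun y => Q.eval y * Real.exp (-l * y))
      ((expDeriv l Q).eval t * Real.exp (-l * t)) t := by
  refine ((Q.hasDerivAt t).mul (((hasDerivAt_id t).const_mul (-l)).exp)).congr_deriv ?_
  simp only [expDeriv_apply, eval_sub, eval_mul, eval_C, id]
  ring

theorem integral_modeLap_mul_poly (l : ℝ) {χ : 𝓢(ℝ, ℝ)} (hχ : χ ∈ halfLineTest) (Q : ℝ[X]) :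
    ∫ t in Ioi 0, modeLap l χ t * (Q.eval t * Real.exp (-l * t))
      = ∫ t in Ioi 0, χ t * ((expLap l Q).eval t * Real.exp (-l * t)) := by
  rw [setIntegral_test_mul (modeLap_mem l hχ) fun t => Q.eval t * Real.exp (-l * t),
    setIntegral_test_mul hχ fun t => (expLap l Q).eval t * Real.exp (-l * t), modeLap_eq_modeShift,
    integral_mul_modeShift l (modeShift_mem _ hχ).1 (hasDerivAt_poly_mul_exp l Q) (by fun_prop)]
  have h1 : ∀ t : ℝ, (expDeriv l Q).eval t * Real.exp (-l * t)
      + l * (Q.eval t * Real.exp (-l * t)) = (derivative Q).eval t * Real.exp (-l * t) := by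
    intro t
    simp only [expDeriv_apply, eval_sub, eval_mul, eval_C]
    ring
  simp only [h1]
  rw [integral_mul_modeShift (-l) hχ.1 (hasDerivAt_poly_mul_exp l (derivative Q)) (by fun_prop),
    neg_neg]
  refine integral_congr_ae (.of_forall fun t => ?_)
  simp only [expDeriv_apply, expLap_apply, eval_sub, eval_mul, eval_C]
  ring

theorem integral_modeLap_iterate_mul_poly (l : ℝ) (k : ℕ) (Q : ℝ[X]) : ∀ {χ : 𝓢(ℝ, ℝ)},
    χ ∈ halfLineTest → ∫ t in Ioi 0, (modeLap l)^[k] χ t * (Q.eval t * Real.exp (-l * t))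
      = ∫ t in Ioi 0, χ t * (((expLap l ^ k) Q).eval t * Real.exp (-l * t)) := by
  induction k with
  | zero => intro χ _; rfl
  | succ k ih =>
    intro χ hχ
    rw [Function.iterate_succ_apply, ih (modeLap_mem l hχ), integral_modeLap_mul_poly l hχ,
      pow_succ',
      Module.End.mul_apply]

/-- The trace at `0` of a function `P e^{-ly}` whose weak derivative is `g`. -/
theorem trace_poly_mul_exp {l : ℝ} (hl : 0 < l) {P : ℝ[X]} {b : ℝ} {f g : ℝ → ℝ}
    (hf : f =ᵐ[volume.restrict (Ioi 0)] fun y => P.eval y * Real.exp (-l * y))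
    (hg : MemLp g 2 (volume.restrict (Ioi 0)))
    (h : ∀ χ : 𝓢(ℝ, ℝ), HasCompactSupport χ →
      ∫ t in Ioi 0, (deriv χ t * f t + χ t * g t) = -(χ 0 * b)) :
    g =ᵐ[volume.restrict (Ioi 0)] (fun y => (expDeriv l P).eval y * Real.exp (-l * y)) ∧
      P.eval 0 = b := by
  have hD := memLp_poly_mul_exp_neg hl (expDeriv l P)
  have h1 : ∀ χ : 𝓢(ℝ, ℝ), HasCompactSupport χ →
      (∫ t in Ioi 0, χ t * g t)
        - ∫ t in Ioi 0, χ t * ((expDeriv l P).eval t * Real.exp (-l * t))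
        = χ 0 * (P.eval 0 - b) := by
    intro χ hχ
    have h2 := HasCompactSupport.integral_Ioi_deriv_eq
      (f := fun t => χ t * (P.eval t * Real.exp (-l * t)))
      ((χ.smooth 1).mul ((by simpa using P.contDiff_aeval (𝕜 := ℝ) 1 :
        ContDiff ℝ 1 fun t => P.eval t).mul (by fun_prop))) hχ.mul_right 0
    have h3 : ∀ t, deriv (fun t => χ t * (P.eval t * Real.exp (-l * t))) t
        = deriv χ t * (P.eval t * Real.exp (-l * t))
          + χ t * ((expDeriv l P).eval t * Real.exp (-l * t)) := fun t =>
      ((χ.hasDerivAt t).mul (hasDerivAt_poly_mul_exp l P t)).deriv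
    simp only [h3] at h2
    have hP := memLp_poly_mul_exp_neg hl P
    have i1 : Integrable (fun t => deriv χ t * (P.eval t * Real.exp (-l * t)))
        (volume.restrict (Ioi 0)) :=
      integrable_schwartz_mul_memLp (SchwartzMap.derivCLM ℝ ℝ χ) hP
    have h4 := h χ hχ
    rw [integral_congr_ae (g := fun t => deriv χ t * (P.eval t * Real.exp (-l * t)) + χ t * g t)
      (by filter_upwards [hf] with t ht; rw [ht]),
      integral_add i1 (integrable_schwartz_mul_memLp χ hg)] at h4
    rw [integral_add i1 (integrable_schwartz_mul_memLp χ hD)] at h2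
    simp only [mul_zero, Real.exp_zero, mul_one] at h2
    linarith
  -- Test functions supported away from `0` do not see the boundary term and identify `g`.
  have h5 : g =ᵐ[volume.restrict (Ioi 0)] fun y => (expDeriv l P).eval y * Real.exp (-l * y) := by
    refine ae_eq_of_forall_halfLineTest (locallyIntegrableOn_of_memLp hg)
      (locallyIntegrableOn_of_memLp hD) fun χ hχ => ?_
    have h6 := h1 χ hχ.1
    rw [image_eq_zero_of_notMem_tsupport (f := (χ : ℝ → ℝ)) fun h => lt_irrefl (0 : ℝ) (hχ.2 h),
      zero_mul] at h6
    exact sub_eq_zero.1 h6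
  refine ⟨h5, ?_⟩
  -- With `g` known, a test function equal to `1` at `0` reads off the boundary value.
  let bump : ContDiffBump (0 : ℝ) := default
  have hb := h1 (bump.hasCompactSupport.toSchwartzMap bump.contDiff) bump.hasCompactSupport
  rw [integral_congr_ae (g := fun t => (bump.hasCompactSupport.toSchwartzMap bump.contDiff) t
    * ((expDeriv l P).eval t * Real.exp (-l * t)))
    (by filter_upwards [h5] with t ht; rw [ht]), sub_self] at hb
  have hb0 : (bump.hasCompactSupport.toSchwartzMap bump.contDiff) 0 = 1 :=
    bump.one_of_mem_closedBall (by simp [bump.rIn_pos.le])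
  rw [hb0, one_mul] at hb
  linarith

theorem integral_sq_of_ae_eq_poly {l : ℝ} {P : ℝ[X]} {f : ℝ → ℝ}
    (hf : f =ᵐ[volume.restrict (Ioi 0)] fun y => P.eval y * Real.exp (-l * y)) :
    ∫ t in Ioi 0, f t ^ 2 = expInt l (P * P) := by
  refine integral_congr_ae ?_
  filter_upwards [hf] with t ht
  have : Real.exp (-(2 * l) * t) = Real.exp (-l * t) * Real.exp (-l * t) := by
    rw [← Real.exp_add]; ring_nf
  rw [ht, eval_mul, this]
  ring

/-- The one-dimensional boundary value problem at a frequency of modulus `l`. -/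
theorem halfLine_energy {l : ℝ} (hl : 0 < l) {m : ℕ} (hm : 1 ≤ m) (a : ℝ) {w z y : ℕ → ℝ → ℝ}
    (hw : ∀ k, 2 * k ≤ m → MemLp (w k) 2 (volume.restrict (Ioi 0)))
    (hz : ∀ k, 2 * k + 1 ≤ m → MemLp (z k) 2 (volume.restrict (Ioi 0)))
    (hy : ∀ k, 2 * k + 2 ≤ m → MemLp (y k) 2 (volume.restrict (Ioi 0)))
    (h0 : ∀ χ ∈ halfLineTest, ∫ t in Ioi 0, ((modeLap l)^[m] χ) t * w 0 t = 0)
    (h1 : ∀ k, 2 * k ≤ m → ∀ χ ∈ halfLineTest,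
      ∫ t in Ioi 0, ((modeLap l)^[k] χ) t * w 0 t = ∫ t in Ioi 0, χ t * w k t)
    (h2 : ∀ k, 2 * k + 1 ≤ m → ∀ χ : 𝓢(ℝ, ℝ), HasCompactSupport χ →
      ∫ t in Ioi 0, (deriv χ t * w k t + χ t * z k t) = -(χ 0 *
        (Real.Gamma m * Real.Gamma ((m : ℝ) - 1 / 2 - k) /
          (Real.Gamma ((m : ℝ) - k) * Real.Gamma ((m : ℝ) - 1 / 2)) * (-l ^ 2) ^ k * a)))
    (h3 : ∀ k, 2 * k + 2 ≤ m → ∀ χ : 𝓢(ℝ, ℝ), HasCompactSupport χ →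
      ∫ t in Ioi 0, (deriv χ t * z k t + χ t * y k t) = 0) :
    (if Even m then ∫ t in Ioi 0, w (m / 2) t ^ 2
      else l ^ 2 * (∫ t in Ioi 0, w (m / 2) t ^ 2) + ∫ t in Ioi 0, z (m / 2) t ^ 2)
      = Real.Gamma m * Real.Gamma (1 / 2) / Real.Gamma ((m : ℝ) - 1 / 2) * l ^ (2 * m - 1)
        * a ^ 2 := by
  obtain ⟨Q, hQ, hQw⟩ := exists_poly_of_weak_modeLap hl hm (hw 0 (by omega)) h0
  have hwk : ∀ k, 2 * k ≤ m → w k =ᵐ[volume.restrict (Ioi 0)]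
      fun t => ((expLap l ^ k) Q).eval t * Real.exp (-l * t) := by
    intro k hk
    refine ae_eq_of_forall_halfLineTest (locallyIntegrableOn_of_memLp (hw k hk))
      (locallyIntegrableOn_of_memLp (memLp_poly_mul_exp_neg hl _)) fun χ hχ => ?_
    rw [← h1 k hk χ hχ, ← integral_modeLap_iterate_mul_poly l k Q hχ]
    refine integral_congr_ae ?_
    filter_upwards [hQw] with t ht
    rw [ht]
  -- The trace lemma is used twice: on `w k` it identifies `z k` and the boundary value, and on `z
  -- k` it gives the vanishing normal derivative.
  have hzk := fun k (hk : 2 * k + 1 ≤ m) =>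
    trace_poly_mul_exp hl (hwk k (by omega)) (hz k hk) (h2 k hk)
  have hyk := fun k (hk : 2 * k + 2 ≤ m) =>
    trace_poly_mul_exp hl (b := 0) (hzk k (by omega)).1 (hy k hk)
      (fun χ hχ => by rw [h3 k hk χ hχ, mul_zero, neg_zero])
  rw [← expEnergy_of_boundary hl hm hQ a (fun k hk => (hzk k hk).2) (fun k hk => (hyk k hk).2),
    expEnergy]
  split_ifs with he
  · exact integral_sq_of_ae_eq_poly (hwk _ (by omega))
  · have := Nat.not_even_iff_odd.1 he
    have h5 : 2 * (m / 2) + 1 ≤ m := by obtain ⟨j, rfl⟩ := this; omega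
    rw [integral_sq_of_ae_eq_poly (hwk _ (by omega)), integral_sq_of_ae_eq_poly (hzk _ h5).1]

end HalfSpace

/-! ### Density of real test functions, Fourier identities, and `L²`-valued lifts. -/

namespace HalfSpace

open Set Filter
open scoped SchwartzMap ContDiff FourierTransform LineDeriv Laplacian Topology

section Density

variable {E : Type*} [NormedAddCommGroup E] [InnerProductSpace ℝ E] [FiniteDimensional ℝ E]

/-- A smooth cutoff, equal to `1` on the ball of radius `n + 1`. -/
noncomputable def cutoff (n : ℕ) (x : E) : ℝ :=
  (⟨1, 2, one_pos, one_lt_two⟩ : ContDiffBump (0 : E)) (((n : ℝ) + 1)⁻¹ • x)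

theorem contDiff_cutoff (n : ℕ) : ContDiff ℝ ∞ (cutoff n : E → ℝ) :=
  (⟨1, 2, one_pos, one_lt_two⟩ : ContDiffBump (0 : E)).contDiff.comp (contDiff_const_smul _)

theorem hasCompactSupport_cutoff (n : ℕ) : HasCompactSupport (cutoff n : E → ℝ) :=
  (⟨1, 2, one_pos, one_lt_two⟩ : ContDiffBump (0 : E)).hasCompactSupport.comp_homeomorph
    (Homeomorph.smulOfNeZero (((n : ℝ) + 1)⁻¹) (by positivity))

theorem cutoff_eq_one {n : ℕ} {x : E} (hx : ‖x‖ ≤ n + 1) : cutoff n x = 1 := by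
  refine ContDiffBump.one_of_mem_closedBall _ ?_
  rw [mem_closedBall_zero_iff, norm_smul, norm_inv, Real.norm_of_nonneg (by positivity)]
  exact (inv_mul_le_one₀ (by positivity)).2 hx

/-- Rescaling by `1/(n+1) ≤ 1` can only shrink derivatives, so the bound is uniform in `n`. -/
theorem exists_bound_iteratedFDeriv_cutoff (i : ℕ) :
    ∃ C : ℝ, ∀ (n : ℕ) (x : E), ‖iteratedFDeriv ℝ i (fun y => cutoff n y - 1) x‖ ≤ C := by
  set κ : ContDiffBump (0 : E) := ⟨1, 2, one_pos, one_lt_two⟩ with hκ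
  have hc : HasCompactSupport (iteratedFDeriv ℝ i κ) := κ.hasCompactSupport.iteratedFDeriv i
  obtain ⟨C, hC⟩ := (κ.contDiff.continuous_iteratedFDeriv
    (m := i) (n := ∞) (by exact_mod_cast le_top)).bounded_above_of_compact_support hc
  refine ⟨C + 1, fun n x => ?_⟩
  have h1 : ‖iteratedFDeriv ℝ i (cutoff n : E → ℝ) x‖ ≤ C := by
    have h2 := ContinuousLinearMap.iteratedFDeriv_comp_right
      ((((n : ℝ) + 1)⁻¹) • ContinuousLinearMap.id ℝ E) (κ.contDiff (n := ⊤)) x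
      (i := i) (by exact_mod_cast le_top)
    have h3 : (cutoff n : E → ℝ) = κ ∘ ((((n : ℝ) + 1)⁻¹) • ContinuousLinearMap.id ℝ E) := rfl
    rw [h3, h2]
    refine (ContinuousMultilinearMap.norm_compContinuousLinearMap_le _ _).trans ?_
    rw [Finset.prod_const, Finset.card_univ, Fintype.card_fin]
    refine (mul_le_of_le_one_right (norm_nonneg _) (pow_le_one₀ (norm_nonneg _) ?_)).trans (hC _)
    refine (norm_smul_le _ _).trans ?_
    rw [norm_inv, Real.norm_of_nonneg (by positivity)]
    exact mul_le_one₀ (inv_le_one_of_one_le₀ (by simp)) (norm_nonneg _)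
      ContinuousLinearMap.norm_id_le
  rcases Nat.eq_zero_or_pos i with rfl | hi
  · rw [norm_iteratedFDeriv_zero] at h1 ⊢
    exact (norm_sub_le _ _).trans (by simpa using h1)
  · have h4 : iteratedFDeriv ℝ i (fun y => cutoff n y - 1) x = iteratedFDeriv ℝ i (cutoff n) x := by
      have := iteratedFDeriv_sub_apply (𝕜 := ℝ) (i := i) (x := x) (f := (cutoff n : E → ℝ))
        (g := fun _ => (1 : ℝ)) ((contDiff_cutoff n).contDiffAt.of_le (by exact_mod_cast le_top))
        contDiffAt_const
      rw [iteratedFDeriv_const_of_ne (by omega), Pi.zero_apply, sub_zero] at this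
      exact this
    rw [h4]
    linarith

/-- Truncation of a Schwartz function. -/
noncomputable def truncate (n : ℕ) (η : 𝓢(E, ℂ)) : 𝓢(E, ℂ) :=
  (show HasCompactSupport fun x => cutoff n x • η x from
    (hasCompactSupport_cutoff n).smul_right).toSchwartzMap ((contDiff_cutoff n).smul (η.smooth ⊤))

theorem truncate_apply (n : ℕ) (η : 𝓢(E, ℂ)) (x : E) : truncate n η x = cutoff n x • η x := rfl

/-- The error lives where `‖x‖ ≥ n + 1`, so one extra power of `‖x‖` in the seminorm gains a factor
`1/(n+1)`. -/
theorem tendsto_truncate (η : 𝓢(E, ℂ)) :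
    Tendsto (fun n => truncate n η) atTop (𝓝 η) := by
  rw [(schwartz_withSeminorms ℝ E ℂ).tendsto_nhds]
  rintro ⟨k, l⟩ ε hε
  choose C hC using fun i => exists_bound_iteratedFDeriv_cutoff (E := E) i
  have hC0 : ∀ i, 0 ≤ C i := fun i => (norm_nonneg _).trans (hC i 0 0)
  set M : ℝ := ∑ i ∈ Finset.range (l + 1),
    (l.choose i : ℝ) * C i * SchwartzMap.seminorm ℝ (k + 1) (l - i) η with hM
  have hM0 : 0 ≤ M := Finset.sum_nonneg fun i _ =>
    mul_nonneg (mul_nonneg (by positivity) (hC0 i)) (apply_nonneg _ _)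
  have hb : ∀ n : ℕ, SchwartzMap.seminorm ℝ k l (truncate n η - η) ≤ M / (n + 1) := by
    intro n
    refine SchwartzMap.seminorm_le_bound ℝ k l _ (by positivity) fun x => ?_
    have he : ((truncate n η - η : 𝓢(E, ℂ)) : E → ℂ) = fun y => (cutoff n y - 1) • η y := by
      ext y
      rw [sub_apply, truncate_apply, sub_smul, one_smul]
    rw [he]
    rcases lt_or_ge ‖x‖ (n + 1) with hx | hx
    · have : (fun y => (cutoff n y - 1) • η y) =ᶠ[𝓝 x] fun _ => 0 := by
        filter_upwards [(isOpen_lt continuous_norm continuous_const).mem_nhds hx] with y hy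
        rw [cutoff_eq_one (le_of_lt hy), sub_self, zero_smul]
      rw [(this.iteratedFDeriv ℝ l).eq_of_nhds]
      have h0 : iteratedFDeriv ℝ l (fun _ : E => (0 : ℂ)) x = 0 := by
        simp
      rw [h0, norm_zero, mul_zero]
      positivity
    · have h1 := norm_iteratedFDeriv_smul_le (𝕜 := ℝ) (N := ∞) (n := l)
        ((contDiff_cutoff n).sub (contDiff_const (c := (1 : ℝ)))) (η.smooth ⊤) x
        (by exact_mod_cast le_top)
      rw [le_div_iff₀ (by positivity)]
      calc _ ≤ ‖x‖ ^ k * (∑ i ∈ Finset.range (l + 1), (l.choose i : ℝ)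
            * ‖iteratedFDeriv ℝ i (fun y => cutoff n y - 1) x‖ * ‖iteratedFDeriv ℝ (l - i) η x‖)
              * ‖x‖ := by gcongr
        _ = ∑ i ∈ Finset.range (l + 1), (l.choose i : ℝ)
            * ‖iteratedFDeriv ℝ i (fun y => cutoff n y - 1) x‖
              * (‖x‖ ^ (k + 1) * ‖iteratedFDeriv ℝ (l - i) η x‖) := by
          rw [Finset.mul_sum, Finset.sum_mul]
          exact Finset.sum_congr rfl fun i _ => by ring
        _ ≤ M := by
          refine Finset.sum_le_sum fun i _ => ?_
          have := hC i n x
          have := SchwartzMap.le_seminorm ℝ (k + 1) (l - i) η x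
          have := hC0 i
          gcongr
  have h2 : Tendsto (fun n : ℕ => M / (n + 1)) atTop (𝓝 0) :=
    tendsto_const_div_atTop_nhds_zero_nat M |>.comp (tendsto_add_atTop_nat 1) |>.congr fun n => by
      simp
  filter_upwards [h2.eventually_lt_const hε] with n hn
  exact (hb n).trans_lt hn

/-- A tempered distribution that vanishes on real test functions vanishes. -/
theorem eq_zero_of_forall_real_test {T : 𝓢(E, ℂ) →L[ℂ] ℂ}
    (h : ∀ η : 𝓢(E, ℝ), HasCompactSupport η →
      T (SchwartzMap.postcompCLM Complex.ofRealCLM η) = 0) (η : 𝓢(E, ℂ)) : T η = 0 := by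
  have h1 : ∀ η : 𝓢(E, ℂ), HasCompactSupport η → T η = 0 := by
    intro η hη
    have e : η = SchwartzMap.postcompCLM Complex.ofRealCLM (SchwartzMap.postcompCLM Complex.reCLM η)
        + Complex.I • SchwartzMap.postcompCLM Complex.ofRealCLM
          (SchwartzMap.postcompCLM Complex.imCLM η) := by
      ext x
      simp [SchwartzMap.postcompCLM_apply, mul_comm Complex.I]
    have hre : HasCompactSupport (SchwartzMap.postcompCLM Complex.reCLM η) :=
      hη.mono fun x hx h0 => hx (by rw [SchwartzMap.postcompCLM_apply, h0, map_zero])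
    have him : HasCompactSupport (SchwartzMap.postcompCLM Complex.imCLM η) :=
      hη.mono fun x hx h0 => hx (by rw [SchwartzMap.postcompCLM_apply, h0, map_zero])
    rw [e, map_add, map_smul, h _ hre, h _ him, smul_zero, add_zero]
  refine tendsto_nhds_unique ((T.continuous.tendsto η).comp (tendsto_truncate η)) ?_
  refine tendsto_const_nhds.congr fun n => (h1 (truncate n η) ?_).symm
  exact (hasCompactSupport_cutoff n).smul_right

end Density

section Fourier

variable {E : Type*} [NormedAddCommGroup E] [InnerProductSpace ℝ E] [FiniteDimensional ℝ E]
  [MeasurableSpace E] [BorelSpace E]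

theorem ae_eq_zero_of_forall_schwartz {h : E → ℂ} (hh : LocallyIntegrable h)
    (h0 : ∀ θ : 𝓢(E, ℂ), HasCompactSupport θ → ∫ x, θ x • h x = 0) : ∀ᵐ x, h x = 0 := by
  refine ae_eq_zero_of_integral_contDiff_smul_eq_zero hh fun g hs hc => ?_
  have := h0 (SchwartzMap.postcompCLM Complex.ofRealCLM (hc.toSchwartzMap hs))
    (hc.comp_left Complex.ofReal_zero)
  simpa [SchwartzMap.postcompCLM_apply] using this

theorem integral_fourier_smul_Lp {G : Type*} [NormedAddCommGroup G] [InnerProductSpace ℂ G]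
    [CompleteSpace G] (f : Lp G 2 (volume : Measure E)) (θ : 𝓢(E, ℂ)) :
    ∫ x, 𝓕 θ x • f x = ∫ ξ, θ ξ • (𝓕 f : Lp G 2 (volume : Measure E)) ξ := by
  rw [← Lp.toTemperedDistribution_apply, ← Lp.toTemperedDistribution_apply,
    ← Lp.fourier_toTemperedDistribution_eq, TemperedDistribution.fourier_apply]

theorem exists_lineDeriv_fourier (θ : 𝓢(E, ℂ)) (v : E) :
    ∃ θ' : 𝓢(E, ℂ), (∀ x, θ' x = -(2 * Real.pi * Complex.I) * inner ℝ x v * θ x) ∧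
      ∂_{v} (𝓕 θ) = 𝓕 θ' := by
  refine ⟨_, fun x => ?_, SchwartzMap.lineDerivOp_fourier_eq θ v⟩
  have : (inner ℝ · v : E → ℝ).HasTemperateGrowth := ((innerSL ℝ).flip v).hasTemperateGrowth
  simp [this, mul_assoc]

theorem exists_laplacian_fourier (θ : 𝓢(E, ℂ)) :
    ∃ θ' : 𝓢(E, ℂ), (∀ x, θ' x = ((-(2 * Real.pi * ‖x‖) ^ 2 : ℝ) : ℂ) * θ x) ∧
      Δ (𝓕 θ) = 𝓕 θ' := by
  set b := stdOrthonormalBasis ℝ E with hb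
  choose A hA hA' using fun v => fun θ : 𝓢(E, ℂ) => exists_lineDeriv_fourier θ v
  refine ⟨∑ i, A (b i) (A (b i) θ), fun x => ?_, ?_⟩
  · have h1 : ∀ i, A (b i) (A (b i) θ) x
        = ((-(2 * Real.pi) ^ 2 * (inner ℝ x (b i)) ^ 2 : ℝ) : ℂ) * θ x := fun i => by
      rw [hA, hA]
      push_cast
      linear_combination (4 * Real.pi ^ 2 * (inner ℝ x (b i)) ^ 2 * θ x) * Complex.I_sq
    rw [sum_apply, Finset.sum_congr rfl fun i _ => h1 i, ← Finset.sum_mul,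
      ← Complex.ofReal_sum, ← Finset.mul_sum, b.sum_sq_inner_left]
    congr 2
    ring
  · rw [SchwartzMap.laplacian_eq_sum b]
    simp only [hA']
    exact (map_sum (SchwartzMap.fourierTransformCLM ℂ) _ _).symm

end Fourier

section Lift

variable {X Y : Type*} [MeasurableSpace X] [MeasurableSpace Y] {μ : Measure X} {ν : Measure Y}

/-- In a second countable space every open set is a countable union of balls. -/
theorem measurable_of_preimage_ball {F : Type*} [PseudoMetricSpace F] [SecondCountableTopology F]
    [MeasurableSpace F] [BorelSpace F] {G : X → F}
    (h : ∀ c r, MeasurableSet (G ⁻¹' Metric.ball c r)) : Measurable G := by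
  refine measurable_of_isOpen fun U hU => ?_
  choose r hr hrU using fun c : U => Metric.isOpen_iff.1 hU c c.2
  obtain ⟨s, hs, hU'⟩ := isOpen_iUnion_countable (fun c : U => Metric.ball (c : F) (r c))
    fun _ => Metric.isOpen_ball
  have : U = ⋃ c ∈ s, Metric.ball (c : F) (r c) := by
    rw [hU']
    ext x
    refine ⟨fun hx => mem_iUnion.2 ⟨⟨x, hx⟩, Metric.mem_ball_self (hr ⟨x, hx⟩)⟩, fun hx => ?_⟩
    obtain ⟨c, hc⟩ := mem_iUnion.1 hx
    exact hrU c hc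
  rw [this, preimage_iUnion₂]
  exact MeasurableSet.biUnion hs fun c _ => h _ _

theorem memLp_two_iff_lintegral {f : Y → ℂ} (hf : AEStronglyMeasurable f ν) :
    MemLp f 2 ν ↔ ∫⁻ y, ‖f y‖ₑ ^ 2 ∂ν < ⊤ := by
  rw [MemLp, and_iff_right hf, eLpNorm_lt_top_iff_lintegral_rpow_enorm_lt_top (by simp) (by simp)]
  simp

theorem enorm_sq_Lp {G : Type*} [NormedAddCommGroup G] (f : Lp G 2 ν) :
    ‖f‖ₑ ^ 2 = ∫⁻ y, ‖f y‖ₑ ^ 2 ∂ν := by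
  rw [Lp.enorm_def, eLpNorm_eq_lintegral_rpow_enorm_toReal (by simp) (by simp)]
  simp only [ENNReal.toReal_ofNat, ENNReal.rpow_ofNat]
  rw [← ENNReal.rpow_natCast, ← ENNReal.rpow_mul]
  norm_num

/-- An `L²` function of two variables, as an `L²`-valued `L²` function. -/
theorem exists_lift [SFinite μ] [SFinite ν] [SecondCountableTopology (Lp ℂ 2 ν)] {f : X × Y → ℂ}
    (hf : MemLp f 2 (μ.prod ν)) :
    ∃ G : Lp (Lp ℂ 2 ν) 2 μ, ∀ᵐ x ∂μ, (G x : Y → ℂ) =ᵐ[ν] fun y => f (x, y) := by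
  classical
  borelize ↥(Lp ℂ 2 ν)
  set g := hf.1.mk f with hg
  have hgm : Measurable g := hf.1.stronglyMeasurable_mk.measurable
  have hfg : ∀ᵐ x ∂μ, ∀ᵐ y ∂ν, f (x, y) = g (x, y) := Measure.ae_ae_of_ae_prod hf.1.ae_eq_mk
  have hgx : ∀ x, AEStronglyMeasurable (fun y => g (x, y)) ν := fun x =>
    (hgm.comp measurable_prodMk_left).aestronglyMeasurable
  have hsec : ∀ h : X × Y → ℂ, Measurable h → Measurable fun x => ∫⁻ y, ‖h (x, y)‖ₑ ^ 2 ∂ν :=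
    fun h hh => (hh.enorm.pow_const 2).lintegral_prod_right'
  have hg2 : ∫⁻ x, ∫⁻ y, ‖g (x, y)‖ₑ ^ 2 ∂ν ∂μ < ⊤ := by
    rw [← lintegral_prod _ (hgm.enorm.pow_const 2).aemeasurable,
      ← memLp_two_iff_lintegral hgm.aestronglyMeasurable]
    exact hf.ae_eq hf.1.ae_eq_mk
  set G : X → Lp ℂ 2 ν := fun x =>
    if h : MemLp (fun y => g (x, y)) 2 ν then h.toLp else 0 with hG
  have hS : MeasurableSet {x | MemLp (fun y => g (x, y)) 2 ν} := by
    simp only [memLp_two_iff_lintegral (hgx _)]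
    exact measurableSet_lt (hsec g hgm) measurable_const
  have hae : ∀ᵐ x ∂μ, MemLp (fun y => g (x, y)) 2 ν := by
    filter_upwards [ae_lt_top (hsec g hgm) hg2.ne] with x hx
    exact (memLp_two_iff_lintegral (hgx x)).2 hx
  have hGm : Measurable G := by
    refine measurable_of_preimage_ball fun c r => ?_
    have hc : Measurable fun p : X × Y => g p - c p.2 :=
      hgm.sub ((Lp.stronglyMeasurable c).measurable.comp measurable_snd)
    -- Membership in the ball is a condition on `∫ |g(x, y) - c(y)|² dy`, measurable in `x` by
    -- Tonelli. The second piece collects the points where `G` takes its default value `0`.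
    have : G ⁻¹' Metric.ball c r = ({x | MemLp (fun y => g (x, y)) 2 ν} ∩
        {x | ∫⁻ y, ‖g (x, y) - c y‖ₑ ^ 2 ∂ν < (ENNReal.ofReal r) ^ 2}) ∪
        ({x | MemLp (fun y => g (x, y)) 2 ν}ᶜ ∩ {_x | (0 : Lp ℂ 2 ν) ∈ Metric.ball c r}) := by
      ext x
      by_cases hx : MemLp (fun y => g (x, y)) 2 ν
      · have e : ‖hx.toLp - c‖ₑ ^ 2 = ∫⁻ y, ‖g (x, y) - c y‖ₑ ^ 2 ∂ν := by
          rw [enorm_sq_Lp]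
          refine lintegral_congr_ae ?_
          filter_upwards [Lp.coeFn_sub hx.toLp c, hx.coeFn_toLp] with y h1 h2
          rw [h1, Pi.sub_apply, h2]
        simp only [mem_preimage, mem_union, mem_inter_iff, mem_ofPred_eq, hx, true_and,
          mem_compl_iff, not_true_eq_false, false_and, or_false, hG, dite_true, ← e,
          mem_ball_iff_norm]
        rw [← ofReal_norm]
        rcases le_or_gt r 0 with hr | hr
        · simp [ENNReal.ofReal_eq_zero.2 hr, (hr.trans (norm_nonneg _)).not_gt]
        · rw [(ENNReal.pow_right_strictMono two_ne_zero).lt_iff_lt, ENNReal.ofReal_lt_ofReal_iff hr]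
      · simp [hG, hx]
    rw [this]
    exact (hS.inter (measurableSet_lt (hsec _ hc) measurable_const)).union
      (hS.compl.inter (MeasurableSet.const _))
  have hGL : MemLp G 2 μ := by
    refine ⟨hGm.aestronglyMeasurable, ?_⟩
    rw [eLpNorm_lt_top_iff_lintegral_rpow_enorm_lt_top (by simp) (by simp)]
    simp only [ENNReal.toReal_ofNat, ENNReal.rpow_ofNat]
    refine lt_of_le_of_lt (lintegral_mono_ae ?_) hg2
    filter_upwards [hae] with x hx
    simp only [hG, hx, dite_true, enorm_sq_Lp]
    refine (lintegral_congr_ae ?_).le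
    filter_upwards [hx.coeFn_toLp] with y hy
    rw [hy]
  refine ⟨hGL.toLp, ?_⟩
  filter_upwards [hGL.coeFn_toLp, hae, hfg] with x h1 h2 h3
  rw [h1]
  simp only [hG, h2, dite_true]
  filter_upwards [h2.coeFn_toLp, h3] with y h4 h5
  rw [h4, h5]

end Lift

end HalfSpace

/-! ### Weak derivatives and weak powers of the Laplacian on the half space. -/

namespace HalfSpace

open Set Filter
open scoped Distributions FourierTransform Laplacian SchwartzMap LineDeriv ContDiff

variable {d : ℕ}

theorem isOpen_upper : IsOpen (upper d : Set (Bdry d × ℝ)) := (upper d).isOpen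

theorem measurableSet_upper : MeasurableSet (upper d : Set (Bdry d × ℝ)) :=
  isOpen_upper.measurableSet

theorem locallyIntegrableOn_upper {f : Bdry d × ℝ → ℂ}
    (hf : MemLp f 2 (volume.restrict (upper d : Set (Bdry d × ℝ)))) :
    LocallyIntegrableOn f (upper d : Set (Bdry d × ℝ)) :=
  locallyIntegrableOn_of_locallyIntegrable_restrict (hf.locallyIntegrable (by norm_num))

theorem integrable_test_smul {f : Bdry d × ℝ → ℂ}
    (hf : LocallyIntegrableOn f (upper d : Set (Bdry d × ℝ))) (φ : 𝓓(upper d, ℝ)) :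
    Integrable (fun p => φ p • f p) (volume.restrict (upper d : Set (Bdry d × ℝ))) :=
  (integrable_smul_of_tsupport_subset hf φ.contDiff.continuous φ.hasCompactSupport
    φ.tsupport_subset).restrict

theorem lineDerivOp_test_apply {Ω : Opens (Bdry d × ℝ)} (φ : 𝓓(Ω, ℝ)) (v p : Bdry d × ℝ) :
    ∂_{v} φ p = fderiv ℝ φ p v := by
  rw [TestFunction.lineDerivOp_eq_lineDerivCLM ℝ, TestFunction.lineDerivCLM_eq_fderivCLM,
    TestFunction.fderivCLM_apply]
  simp

theorem ae_eq_of_forall_test {f g : Bdry d × ℝ → ℂ}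
    (hf : LocallyIntegrableOn f (upper d : Set (Bdry d × ℝ)))
    (hg : LocallyIntegrableOn g (upper d : Set (Bdry d × ℝ)))
    (h : ∀ φ : 𝓓(upper d, ℝ), ∫ p in upper d, φ p • f p = ∫ p in upper d, φ p • g p) :
    f =ᵐ[volume.restrict (upper d : Set (Bdry d × ℝ))] g := by
  have := isOpen_upper.ae_eq_zero_of_integral_contDiff_smul_eq_zero (hf.sub hg) fun χ hs hc ht => by
    have h1 := h ⟨χ, hs, hc, ht⟩
    have h2 := integral_sub (integrable_test_smul hf ⟨χ, hs, hc, ht⟩)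
      (integrable_test_smul hg ⟨χ, hs, hc, ht⟩)
    rw [h1, sub_self] at h2
    simp only [Pi.sub_apply, smul_sub]
    rw [← h2]
    refine (setIntegral_eq_integral_of_forall_compl_eq_zero fun p hp => ?_).symm
    rw [image_eq_zero_of_notMem_tsupport fun h => hp (ht h), zero_smul, zero_smul, sub_self]
  rw [Filter.EventuallyEq, ae_restrict_iff' measurableSet_upper]
  filter_upwards [this] with t ht h0
  exact sub_eq_zero.1 (ht h0)

theorem HasWeakDeriv.ae_eq {v : Bdry d × ℝ} {f g g' : Bdry d × ℝ → ℂ} (h : HasWeakDeriv v f g)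
    (h' : HasWeakDeriv v f g') : g =ᵐ[volume.restrict (upper d : Set (Bdry d × ℝ))] g' :=
  ae_eq_of_forall_test h.1 h'.1 fun φ => neg_injective ((h.2 φ).symm.trans (h'.2 φ))

theorem HasWeakLapPow.ae_eq {k : ℕ} {f g g' : Bdry d × ℝ → ℂ} (h : HasWeakLapPow k f g)
    (h' : HasWeakLapPow k f g') : g =ᵐ[volume.restrict (upper d : Set (Bdry d × ℝ))] g' :=
  ae_eq_of_forall_test h.1 h'.1 fun φ => (h.2 φ).symm.trans (h'.2 φ)

theorem HasWeakDeriv.weakDeriv {v : Bdry d × ℝ} {f g : Bdry d × ℝ → ℂ} (h : HasWeakDeriv v f g) :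
    HasWeakDeriv v f (weakDeriv v f) := by
  have h' : ∃ g, HasWeakDeriv v f g := ⟨g, h⟩
  rw [HalfSpace.weakDeriv, dif_pos h']
  exact h'.choose_spec

theorem HasWeakLapPow.weakLapPow {k : ℕ} {f g : Bdry d × ℝ → ℂ} (h : HasWeakLapPow k f g) :
    HasWeakLapPow k f (weakLapPow k f) := by
  have h' : ∃ g, HasWeakLapPow k f g := ⟨g, h⟩
  rw [HalfSpace.weakLapPow, dif_pos h']
  exact h'.choose_spec

theorem MemW.memLp {n : ℕ} {f : Bdry d × ℝ → ℂ} (h : MemW n f) :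
    MemLp f 2 (volume.restrict (upper d : Set (Bdry d × ℝ))) := by
  cases n with
  | zero => exact h
  | succ n => exact h.1

theorem MemW.hasWeakDeriv {n : ℕ} {f : Bdry d × ℝ → ℂ} (h : MemW (n + 1) f) (v : Bdry d × ℝ) :
    HasWeakDeriv v f (weakDeriv v f) := by
  obtain ⟨g, hg, -⟩ := h.2 v
  exact hg.weakDeriv

theorem MemW.memLp_weakDeriv {n : ℕ} {f : Bdry d × ℝ → ℂ} (h : MemW (n + 1) f)
    (v : Bdry d × ℝ) :
    MemLp (weakDeriv v f) 2 (volume.restrict (upper d : Set (Bdry d × ℝ))) := by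
  obtain ⟨g, hg, hg'⟩ := h.2 v
  exact hg'.memLp.ae_eq (hg.ae_eq hg.weakDeriv)

theorem HasWeakDeriv.add {v : Bdry d × ℝ} {f f' g g' : Bdry d × ℝ → ℂ}
    (hf : LocallyIntegrableOn f (upper d : Set (Bdry d × ℝ)))
    (hf' : LocallyIntegrableOn f' (upper d : Set (Bdry d × ℝ)))
    (h : HasWeakDeriv v f g) (h' : HasWeakDeriv v f' g') :
    HasWeakDeriv v (f + f') (g + g') := by
  refine ⟨h.1.add h'.1, fun φ => ?_⟩
  have e := integral_add (integrable_test_smul hf (∂_{v} φ)) (integrable_test_smul hf' (∂_{v} φ))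
  have e' := integral_add (integrable_test_smul h.1 φ) (integrable_test_smul h'.1 φ)
  simp only [lineDerivOp_test_apply] at e
  simp only [Pi.add_apply, smul_add]
  rw [e, e', h.2, h'.2, neg_add]

theorem MemW.add {n : ℕ} : ∀ {f f' : Bdry d × ℝ → ℂ}, MemW n f → MemW n f' → MemW n (f + f') := by
  induction n with
  | zero => intro f f' h h'; exact MemLp.add h h'
  | succ n ih =>
    intro f f' h h'
    refine ⟨h.1.add h'.1, fun v => ?_⟩
    obtain ⟨g, hg, hgW⟩ := h.2 v
    obtain ⟨g', hg', hgW'⟩ := h'.2 v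
    exact ⟨g + g', hg.add (locallyIntegrableOn_upper h.1) (locallyIntegrableOn_upper h'.1) hg',
      ih hgW hgW'⟩

/-- The Laplacian of a test function. -/
noncomputable def lapTest {Ω : Opens (Bdry d × ℝ)} (φ : 𝓓(Ω, ℝ)) : 𝓓(Ω, ℝ) :=
  ∂_{ey d} (∂_{ey d} φ : 𝓓(Ω, ℝ)) + ∑ i : Fin d, ∂_{ex i} (∂_{ex i} φ : 𝓓(Ω, ℝ))

/-- In terms of directional derivatives the Laplacian becomes an operator on test functions,
`lapTest`, which can be iterated inside weak formulations. -/
theorem lap_eq_of_contDiff {φ : Bdry d × ℝ → ℝ} (hφ : ContDiff ℝ ∞ φ) (p : Bdry d × ℝ) :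
    lap φ p = fderiv ℝ (fun q => fderiv ℝ φ q (ey d)) p (ey d)
      + ∑ i, fderiv ℝ (fun q => fderiv ℝ φ q (ex i)) p (ex i) := by
  have hd : ∀ {ψ : Bdry d × ℝ → ℝ}, ContDiff ℝ ∞ ψ → ∀ q, HasFDerivAt ψ (fderiv ℝ ψ q) q :=
    fun hψ q => (hψ.differentiable (by simp) q).hasFDerivAt
  have hD : ∀ v, ContDiff ℝ ∞ fun q => fderiv ℝ φ q v := fun v =>
    (hφ.fderiv_right (by simp)).clm_apply contDiff_const
  have hx : ∀ {ψ : Bdry d × ℝ → ℝ}, ContDiff ℝ ∞ ψ → ∀ (x v : Bdry d) (y : ℝ),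
      fderiv ℝ (fun x => ψ (x, y)) x v = fderiv ℝ ψ (x, y) (v, 0) := by
    intro ψ hψ x v y
    have := (hd hψ (x, y)).comp x (f := fun e => (e, y)) (hasFDerivAt_prodMk_left x y)
    rw [show (fun x => ψ (x, y)) = ψ ∘ fun x => (x, y) from rfl, this.fderiv]
    simp
  have hy : ∀ {ψ : Bdry d × ℝ → ℝ}, ContDiff ℝ ∞ ψ → ∀ (x : Bdry d) (y : ℝ),
      deriv (fun y => ψ (x, y)) y = fderiv ℝ ψ (x, y) (ey d) := by
    intro ψ hψ x y
    have := (hd hψ (x, y)).comp_hasDerivAt y ((hasDerivAt_const y x).prodMk (hasDerivAt_id y))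
    exact this.deriv
  obtain ⟨x, y⟩ := p
  rw [lap, add_comm]
  congr 1
  · rw [iteratedDeriv_succ, iteratedDeriv_one]
    have : deriv (fun y => φ (x, y)) = fun y => fderiv ℝ φ (x, y) (ey d) := funext (hy hφ x)
    rw [this]
    exact hy (hD (ey d)) x y
  · rw [InnerProductSpace.laplacian_eq_iteratedFDeriv_orthonormalBasis _
      (EuclideanSpace.basisFun (Fin d) ℝ)]
    refine Finset.sum_congr rfl fun i _ => ?_
    rw [iteratedFDeriv_two_apply]
    simp only [Matrix.cons_val_zero, Matrix.cons_val_one, EuclideanSpace.basisFun_apply]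
    have hs : ContDiff ℝ ∞ fun x : Bdry d => φ (x, y) := hφ.comp (contDiff_id.prodMk contDiff_const)
    have hs' : DifferentiableAt ℝ (fderiv ℝ fun x : Bdry d => φ (x, y)) x :=
      (hs.fderiv_right (m := ∞) (by simp)).differentiable (by simp) x
    have h1 : fderiv ℝ (fderiv ℝ fun x : Bdry d => φ (x, y)) x (EuclideanSpace.single i 1)
        (EuclideanSpace.single i 1)
        = fderiv ℝ (fun x => fderiv ℝ (fun x : Bdry d => φ (x, y)) x (EuclideanSpace.single i 1)) x
          (EuclideanSpace.single i 1) := by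
      rw [fderiv_clm_apply hs' (differentiableAt_const _)]
      simp
    rw [h1]
    simp only [hx hφ]
    exact hx (hD _) x _ y

theorem coe_lapTest {Ω : Opens (Bdry d × ℝ)} (φ : 𝓓(Ω, ℝ)) : ⇑(lapTest φ) = lap φ := by
  ext p
  rw [lap_eq_of_contDiff φ.contDiff]
  have h : ∀ v, (fun q => fderiv ℝ φ q v) = ⇑(∂_{v} φ : 𝓓(Ω, ℝ)) := fun v =>
    funext fun q => (lineDerivOp_test_apply φ v q).symm
  simp only [lapTest, add_apply, sum_apply, h,
    lineDerivOp_test_apply]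

theorem coe_lapTest_iterate {Ω : Opens (Bdry d × ℝ)} (k : ℕ) : ∀ φ : 𝓓(Ω, ℝ),
    ⇑(lapTest^[k] φ) = lap^[k] φ := by
  induction k with
  | zero => intro φ; rfl
  | succ k ih => intro φ; rw [Function.iterate_succ_apply, ih, coe_lapTest]; rfl

theorem exists_hasWeakLapPow_one {n : ℕ} {f : Bdry d × ℝ → ℂ} (hf : MemW (n + 2) f) :
    ∃ g, MemW n g ∧ ∀ φ : 𝓓(upper d, ℝ),
      ∫ p in upper d, lapTest φ p • f p = ∫ p in upper d, φ p • g p := by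
  have h2 : ∀ v : Bdry d × ℝ, ∃ g, MemW n g ∧ ∀ φ : 𝓓(upper d, ℝ),
      ∫ p in upper d, (∂_{v} (∂_{v} φ)) p • f p = ∫ p in upper d, φ p • g p := by
    intro v
    obtain ⟨g, hg, hgW⟩ := hf.2 v
    obtain ⟨g', hg', hgW'⟩ := hgW.2 v
    refine ⟨g', hgW', fun φ => ?_⟩
    simp only [lineDerivOp_test_apply _ v]
    rw [hg.2 (∂_{v} φ)]
    simp only [lineDerivOp_test_apply]
    rw [hg'.2 φ, neg_neg]
  have hfl := locallyIntegrableOn_upper hf.1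
  have hs : ∀ s : Finset (Fin d), ∃ g, MemW n g ∧ ∀ φ : 𝓓(upper d, ℝ),
      ∫ p in upper d, (∂_{ey d} (∂_{ey d} φ) + ∑ i ∈ s, ∂_{ex i} (∂_{ex i} φ)) p • f p
        = ∫ p in upper d, φ p • g p := by
    intro s
    classical
    induction s using Finset.induction_on with
    | empty => simpa using h2 (ey d)
    | insert i s hi ih =>
      obtain ⟨g, hg, hg'⟩ := ih
      obtain ⟨k, hk, hk'⟩ := h2 (ex i)
      refine ⟨g + k, hg.add hk, fun φ => ?_⟩
      simp only [Pi.add_apply, smul_add]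
      rw [integral_add (integrable_test_smul (locallyIntegrableOn_upper hg.memLp) φ)
        (integrable_test_smul (locallyIntegrableOn_upper hk.memLp) φ), ← hg', ← hk',
        ← integral_add (integrable_test_smul hfl _) (integrable_test_smul hfl _)]
      refine integral_congr_ae (.of_forall fun p => ?_)
      simp only [Finset.sum_insert hi, add_apply, ← add_smul]
      congr 1
      ring
  exact hs Finset.univ

/-- A function in `W^{n+2k,2}` has a weak `Δ^k` in `W^{n,2}`. -/
theorem MemW.exists_hasWeakLapPow (k : ℕ) : ∀ {n : ℕ} {f : Bdry d × ℝ → ℂ}, MemW (n + 2 * k) f →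
    ∃ g, HasWeakLapPow k f g ∧ MemW n g := by
  induction k with
  | zero =>
    intro n f hf
    exact ⟨f, ⟨locallyIntegrableOn_upper hf.memLp, fun φ => rfl⟩, hf⟩
  | succ k ih =>
    intro n f hf
    obtain ⟨g, hg, hgW⟩ := ih (n := n + 2) (f := f)
      (by rwa [show n + 2 + 2 * k = n + 2 * (k + 1) by ring])
    obtain ⟨g', hgW', hg'⟩ := exists_hasWeakLapPow_one hgW
    refine ⟨g', ⟨locallyIntegrableOn_upper hgW'.memLp, fun φ => ?_⟩, hgW'⟩
    rw [← hg' φ, ← hg.2 (lapTest φ), coe_lapTest]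
    rfl

theorem MemW.weakLapPow {n k m : ℕ} {f : Bdry d × ℝ → ℂ} (hf : MemW m f) (hm : m = n + 2 * k) :
    HasWeakLapPow k f (weakLapPow k f) ∧
      MemLp (weakLapPow k f) 2 (volume.restrict (upper d : Set (Bdry d × ℝ))) := by
  subst hm
  obtain ⟨g, hg, hgW⟩ := hf.exists_hasWeakLapPow k
  exact ⟨hg.weakLapPow, hgW.memLp.ae_eq (hg.ae_eq hg.weakLapPow)⟩

end HalfSpace

/-! ### The space `L²(0, ∞)` and the partial Fourier transform. -/

namespace HalfSpace

open Set Filter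
open scoped Distributions FourierTransform Laplacian SchwartzMap LineDeriv ContDiff

section HalfLine

theorem integral_norm_sq_Lp {Y G : Type*} [MeasurableSpace Y] {ν : Measure Y}
    [NormedAddCommGroup G] (f : Lp G 2 ν) : ∫ y, ‖f y‖ ^ 2 ∂ν = ‖f‖ ^ 2 := by
  have h : AEStronglyMeasurable (fun y => ‖f y‖ ^ 2) ν :=
    (Lp.aestronglyMeasurable f).norm.pow 2
  rw [integral_eq_lintegral_of_nonneg_ae (.of_forall fun _ => by positivity) h]
  have : ∀ y, ENNReal.ofReal (‖f y‖ ^ 2) = ‖f y‖ₑ ^ 2 := fun y => by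
    rw [ENNReal.ofReal_pow (norm_nonneg _), ofReal_norm]
  simp only [this, ← enorm_sq_Lp]
  simp

theorem integrable_smul_of_memLp {Y G : Type*} [MeasurableSpace Y] {ν : Measure Y} {𝕜 : Type*}
    [RCLike 𝕜] [NormedAddCommGroup G] [NormedSpace 𝕜 G] {g : Y → 𝕜} {f : Y → G}
    (hg : MemLp g 2 ν) (hf : MemLp f 2 ν) : Integrable (fun y => g y • f y) ν :=
  memLp_one_iff_integrable.1 (hf.smul hg)

/-- The space `L²(0, ∞)`. -/
abbrev HalfLineL2 : Type := Lp ℂ 2 (volume.restrict (Ioi (0 : ℝ)))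

instance : SecondCountableTopology HalfLineL2 :=
  haveI : Fact ((2 : ENNReal) ≠ ⊤) := ⟨ENNReal.ofNat_ne_top⟩
  Lp.SecondCountableTopology

theorem memLp_halfLine (χ : 𝓢(ℝ, ℝ)) :
    MemLp (fun t => (χ t : ℂ)) 2 (volume.restrict (Ioi (0 : ℝ))) :=
  ((χ.memLp 2 volume).ofReal (K := ℂ)).restrict _

/-- The restriction of a Schwartz function to the half line. -/
noncomputable def toHalfLine : 𝓢(ℝ, ℝ) →ₗ[ℝ] HalfLineL2 where
  toFun χ := (memLp_halfLine χ).toLp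
  map_add' χ ψ := by
    rw [← MemLp.toLp_add]
    congr 1
    ext t
    simp
  map_smul' c χ := by
    rw [RingHom.id_apply, ← MemLp.toLp_const_smul]
    congr 1
    ext t
    simp

/-- The functional `f ↦ ∫ χ f` on `L²(0, ∞)`. -/
noncomputable def pair (χ : 𝓢(ℝ, ℝ)) : HalfLineL2 →L[ℂ] ℂ := innerSL ℂ (toHalfLine χ)

theorem pair_apply (χ : 𝓢(ℝ, ℝ)) (f : HalfLineL2) : pair χ f = ∫ t in Ioi 0, χ t • f t := by
  rw [pair, innerSL_apply_apply, L2.inner_def]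
  refine integral_congr_ae ?_
  filter_upwards [(memLp_halfLine χ).coeFn_toLp] with t ht
  have : (toHalfLine χ) t = (χ t : ℂ) := ht
  rw [this]
  simp [mul_comm]

theorem pair_sub (χ ψ : 𝓢(ℝ, ℝ)) : pair (χ - ψ) = pair χ - pair ψ := by
  simp [pair]

theorem pair_smul (c : ℝ) (χ : 𝓢(ℝ, ℝ)) : pair (c • χ) = c • pair χ := by
  ext f
  simp [pair, inner_smul_left_eq_smul]

theorem integrable_schwartz_smul (χ : 𝓢(ℝ, ℝ)) (f : HalfLineL2) :
    Integrable (fun t => χ t • f t) (volume.restrict (Ioi 0)) :=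
  integrable_smul_of_memLp ((χ.memLp 2 volume).restrict _) (Lp.memLp f)

theorem clm_pair (L : ℂ →L[ℝ] ℝ) (χ : 𝓢(ℝ, ℝ)) (f : HalfLineL2) :
    L (pair χ f) = ∫ t in Ioi 0, χ t * L (f t) := by
  rw [pair_apply, ← L.integral_comp_comm (integrable_schwartz_smul χ f)]
  simp only [map_smul, smul_eq_mul]

theorem ext_of_forall_halfLineTest {f g : HalfLineL2}
    (h : ∀ χ ∈ halfLineTest, pair χ f = pair χ g) :
    f = g := by
  have hre := ae_eq_of_forall_halfLineTest (locallyIntegrableOn_of_memLp (Lp.memLp f).re)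
    (locallyIntegrableOn_of_memLp (Lp.memLp g).re) fun χ hχ => by
      have := congrArg Complex.reCLM (h χ hχ)
      rwa [clm_pair, clm_pair] at this
  have him := ae_eq_of_forall_halfLineTest (locallyIntegrableOn_of_memLp (Lp.memLp f).im)
    (locallyIntegrableOn_of_memLp (Lp.memLp g).im) fun χ hχ => by
      have := congrArg Complex.imCLM (h χ hχ)
      rwa [clm_pair, clm_pair] at this
  refine Lp.ext ?_
  filter_upwards [hre, him] with t h1 h2
  exact Complex.ext h1 h2

theorem norm_sq_halfLine (f : HalfLineL2) :
    ‖f‖ ^ 2 = (∫ t in Ioi 0, (f t).re ^ 2) + ∫ t in Ioi 0, (f t).im ^ 2 := by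
  have h := integral_add (Lp.memLp f).re.integrable_sq (Lp.memLp f).im.integrable_sq
  simp only [RCLike.re_eq_complex_re, RCLike.im_eq_complex_im] at h
  rw [← integral_norm_sq_Lp, ← h]
  refine integral_congr_ae (.of_forall fun t => ?_)
  simp only [← Complex.normSq_eq_norm_sq, Complex.normSq_apply]
  ring

end HalfLine

section AE

variable {X S H K : Type*} [MeasurableSpace X] {μ : Measure X} [TopologicalSpace H]
  [SecondCountableTopology H] [TopologicalSpace K] [T1Space K] [Zero K]

/-- Almost everywhere vanishing, uniformly in a parameter of a separable space. -/
theorem ae_forall_of_forall_ae (J : S → H) (Λ : X → H → K) (hΛ : ∀ x, Continuous (Λ x))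
    (h : ∀ s, ∀ᵐ x ∂μ, Λ x (J s) = 0) : ∀ᵐ x ∂μ, ∀ s, Λ x (J s) = 0 := by
  -- Density is taken within the range of `J`, where the hypothesis holds. Countably many null sets
  -- are discarded and continuity does the rest.
  obtain ⟨c, hc, hd⟩ := TopologicalSpace.exists_countable_dense (range J)
  have h1 : ∀ᵐ x ∂μ, ∀ y ∈ c, Λ x y = 0 := by
    rw [ae_ball_iff hc]
    rintro ⟨_, s, rfl⟩ _
    exact h s
  filter_upwards [h1] with x hx s
  have hcl : IsClosed {y : range J | Λ x y = 0} :=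
    isClosed_singleton.preimage ((hΛ x).comp continuous_subtype_val)
  exact (hcl.closure_subset_iff.2 fun y hy => hx y hy) (hd ⟨J s, mem_range_self s⟩)

end AE

section Fiber

variable {d : ℕ}

theorem volume_restrict_upper :
    (volume : Measure (Bdry d × ℝ)).restrict (upper d : Set (Bdry d × ℝ))
      = (volume : Measure (Bdry d)).prod (volume.restrict (Ioi 0)) := by
  have : (upper d : Set (Bdry d × ℝ)) = univ ×ˢ Ioi 0 := by
    ext p
    simp [upper]
  rw [this, Measure.volume_eq_prod, ← Measure.prod_restrict, Measure.restrict_univ]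

open Classical in
/-- A square integrable function on the upper half space, as a function of the tangential variable
with values in `L²(0, ∞)`. -/
noncomputable def fiber (f : Bdry d × ℝ → ℂ) : Lp HalfLineL2 2 (volume : Measure (Bdry d)) :=
  if h : ∃ G : Lp HalfLineL2 2 (volume : Measure (Bdry d)),
    ∀ᵐ x, (G x : ℝ → ℂ) =ᵐ[volume.restrict (Ioi 0)] fun y => f (x, y) then h.choose else 0

theorem coe_fiber {f : Bdry d × ℝ → ℂ}
    (hf : MemLp f 2 (volume.restrict (upper d : Set (Bdry d × ℝ)))) :
    ∀ᵐ x, (fiber f x : ℝ → ℂ) =ᵐ[volume.restrict (Ioi 0)] fun y => f (x, y) := by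
  rw [volume_restrict_upper] at hf
  have h := exists_lift hf
  rw [fiber, dif_pos h]
  exact h.choose_spec

/-- The partial Fourier transform, in the tangential variable. -/
noncomputable def fiberFourier (f : Bdry d × ℝ → ℂ) :
    Lp HalfLineL2 2 (volume : Measure (Bdry d)) := 𝓕 (fiber f)

theorem integral_norm_sq_upper {f : Bdry d × ℝ → ℂ}
    (hf : MemLp f 2 (volume.restrict (upper d : Set (Bdry d × ℝ)))) :
    ∫ p in upper d, ‖f p‖ ^ 2 = ∫ ξ, ‖fiberFourier f ξ‖ ^ 2 := by
  rw [integral_norm_sq_Lp, fiberFourier, Lp.norm_fourier_eq, ← integral_norm_sq_Lp]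
  have hi : Integrable (fun p => ‖f p‖ ^ 2)
      ((volume : Measure (Bdry d)).prod (volume.restrict (Ioi 0))) := by
    rw [← volume_restrict_upper]
    exact (memLp_two_iff_integrable_sq_norm hf.1).1 hf
  rw [volume_restrict_upper, integral_prod _ hi]
  refine integral_congr_ae ?_
  filter_upwards [coe_fiber hf] with x hx
  rw [← integral_norm_sq_Lp]
  refine integral_congr_ae ?_
  filter_upwards [hx] with y hy
  rw [hy]

theorem integrable_norm_sq_fiberFourier (f : Bdry d × ℝ → ℂ) :
    Integrable fun ξ => ‖fiberFourier f ξ‖ ^ 2 :=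
  (memLp_two_iff_integrable_sq_norm (Lp.aestronglyMeasurable _)).1 (Lp.memLp _)

/-- Tested against a Schwartz function, the transform moves onto the test function and the bounded
functional passes through the integral. -/
theorem fourier_compLp {E G : Type*} [NormedAddCommGroup E] [InnerProductSpace ℝ E]
    [FiniteDimensional ℝ E] [MeasurableSpace E] [BorelSpace E] [NormedAddCommGroup G]
    [InnerProductSpace ℂ G] [CompleteSpace G] (L : G →L[ℂ] ℂ) (f : Lp G 2 (volume : Measure E)) :
    𝓕 (L.compLp f) = L.compLp (𝓕 f : Lp G 2 (volume : Measure E)) := by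
  have hi : ∀ (g : Lp G 2 (volume : Measure E)) (θ : 𝓢(E, ℂ)), Integrable fun x => θ x • g x :=
    fun g θ => integrable_smul_of_memLp (θ.memLp 2 volume) (Lp.memLp g)
  have hc : ∀ (g : Lp G 2 (volume : Measure E)) (θ : 𝓢(E, ℂ)),
      ∫ x, θ x • (L.compLp g) x = L (∫ x, θ x • g x) := by
    intro g θ
    rw [← L.integral_comp_comm (hi g θ)]
    refine integral_congr_ae ?_
    filter_upwards [L.coeFn_compLp g] with x hx
    rw [hx, map_smul]
  have hl : ∀ g : Lp ℂ 2 (volume : Measure E), LocallyIntegrable g := fun g =>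
    (Lp.memLp g).locallyIntegrable (by norm_num)
  have := ae_eq_zero_of_forall_schwartz ((hl (𝓕 (L.compLp f))).sub (hl (L.compLp (𝓕 f))))
    fun θ _ => by
      have hi' : ∀ (g : Lp ℂ 2 (volume : Measure E)), Integrable fun x => θ x • g x :=
        fun g => integrable_smul_of_memLp (θ.memLp 2 volume) (Lp.memLp g)
      simp only [Pi.sub_apply, smul_sub]
      rw [integral_sub (hi' _) (hi' _), hc, ← integral_fourier_smul_Lp, ← integral_fourier_smul_Lp,
        hc, sub_self]
  refine Lp.ext ?_
  filter_upwards [this] with x hx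
  exact sub_eq_zero.1 hx

/-- The function `x ↦ ∫ χ(y) f(x, y) dy`. -/
noncomputable def slice (χ : 𝓢(ℝ, ℝ)) (f : Bdry d × ℝ → ℂ) : Lp ℂ 2 (volume : Measure (Bdry d)) :=
  (pair χ).compLp (fiber f)

/-- Pairing in `y` commutes with transforming in `x`, so `fiberFourier` can be studied through
scalar functions. -/
theorem fourier_slice (χ : 𝓢(ℝ, ℝ)) (f : Bdry d × ℝ → ℂ) :
    ∀ᵐ ξ, (𝓕 (slice χ f) : Lp ℂ 2 (volume : Measure (Bdry d))) ξ = pair χ (fiberFourier f ξ) := by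
  rw [slice, fourier_compLp]
  exact (pair χ).coeFn_compLp _

theorem exists_tensor_test {Ω : Opens (Bdry d × ℝ)} {η : 𝓢(Bdry d, ℝ)} {χ : 𝓢(ℝ, ℝ)}
    (hη : HasCompactSupport η) (hχ : HasCompactSupport χ)
    (hΩ : tsupport η ×ˢ tsupport χ ⊆ (Ω : Set (Bdry d × ℝ))) :
    ∃ φ : 𝓓(Ω, ℝ), ∀ p, φ p = η p.1 * χ p.2 := by
  have hs : tsupport (fun p : Bdry d × ℝ => η p.1 * χ p.2) ⊆ tsupport η ×ˢ tsupport χ := by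
    refine closure_minimal (fun p hp => ?_) ((isClosed_tsupport _).prod (isClosed_tsupport _))
    exact ⟨subset_tsupport _ (left_ne_zero_of_mul hp), subset_tsupport _ (right_ne_zero_of_mul hp)⟩
  refine ⟨⟨fun p => η p.1 * χ p.2, ?_, ?_, hs.trans hΩ⟩, fun p => rfl⟩
  · exact ((η.smooth ⊤).comp contDiff_fst).mul ((χ.smooth ⊤).comp contDiff_snd)
  · exact (hη.prod hχ).of_isClosed_subset (isClosed_tsupport _) hs

/-- Fubini for product test functions. The factor `χ` need not vanish at `y = 0`, as the trace
conditions require. -/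
theorem integral_tensor {f : Bdry d × ℝ → ℂ}
    (hf : MemLp f 2 (volume.restrict (upper d : Set (Bdry d × ℝ)))) {η : 𝓢(Bdry d, ℝ)}
    {χ : 𝓢(ℝ, ℝ)} (hη : HasCompactSupport η) (hχ : HasCompactSupport χ) :
    Integrable (fun p => (η p.1 * χ p.2) • f p)
        (volume.restrict (upper d : Set (Bdry d × ℝ))) ∧
      ∫ p in upper d, (η p.1 * χ p.2) • f p = ∫ x, η x • slice χ f x := by
  obtain ⟨φ, hφ⟩ := exists_tensor_test (Ω := ⊤) hη hχ fun _ _ => trivial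
  simp only [← hφ]
  have hi : Integrable (fun p => φ p • f p) (volume.restrict (upper d : Set (Bdry d × ℝ))) :=
    integrable_smul_of_memLp ((φ.contDiff.continuous.memLp_of_hasCompactSupport
      φ.hasCompactSupport : MemLp φ 2 volume).restrict _) hf
  refine ⟨hi, ?_⟩
  rw [volume_restrict_upper] at hi ⊢
  rw [integral_prod _ hi]
  refine integral_congr_ae ?_
  filter_upwards [coe_fiber hf, (pair χ).coeFn_compLp (fiber f)] with x hx hx'
  have : slice χ f x = ∫ y in Ioi 0, χ y • f (x, y) := by
    rw [slice, hx', pair_apply]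
    refine integral_congr_ae ?_
    filter_upwards [hx] with y hy
    rw [hy]
  rw [this, ← integral_smul]
  simp only [hφ, mul_smul]

end Fiber

end HalfSpace

/-! ### Powers of the Laplacian on the frequency side. -/

namespace HalfSpace

open Set Filter
open scoped Distributions FourierTransform Laplacian SchwartzMap LineDeriv ContDiff

variable {d : ℕ}

section Functional

variable {E : Type*} [NormedAddCommGroup E] [InnerProductSpace ℝ E]

/-- The complexification of a real Schwartz function. -/
noncomputable def complexify (η : 𝓢(E, ℝ)) : 𝓢(E, ℂ) := SchwartzMap.postcompCLM Complex.ofRealCLM η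

theorem complexify_apply (η : 𝓢(E, ℝ)) (x : E) : complexify η x = η x := rfl

theorem complexify_lineDeriv (η : 𝓢(E, ℝ)) (v : E) :
    complexify (∂_{v} η) = ∂_{v} (complexify η) := by
  ext x
  rw [complexify_apply, SchwartzMap.lineDerivOp_apply_eq_fderiv,
    SchwartzMap.lineDerivOp_apply_eq_fderiv]
  have := (Complex.ofRealCLM.hasFDerivAt (x := η x)).comp x (η.differentiableAt).hasFDerivAt
  rw [show ⇑(complexify η) = Complex.ofRealCLM ∘ η from rfl, this.fderiv]
  rfl

theorem hasCompactSupport_lineDeriv {η : 𝓢(E, ℝ)} (hη : HasCompactSupport η) (v : E) :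
    HasCompactSupport (∂_{v} η : 𝓢(E, ℝ)) :=
  hη.mono' ((subset_tsupport _).trans (SchwartzMap.tsupport_lineDerivOp_subset v η))

theorem hasCompactSupport_deriv {χ : 𝓢(ℝ, ℝ)} (hχ : HasCompactSupport χ) :
    HasCompactSupport (SchwartzMap.derivCLM ℝ ℝ χ) :=
  hχ.mono' ((subset_tsupport _).trans (SchwartzMap.tsupport_derivCLM_subset (𝕜 := ℝ) χ))

variable [FiniteDimensional ℝ E]

theorem complexify_laplacian (η : 𝓢(E, ℝ)) : complexify (Δ η) = Δ (complexify η) := by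
  ext x
  rw [complexify_apply, SchwartzMap.laplacian_apply, SchwartzMap.laplacian_apply]
  exact (((η.smooth 2).contDiffAt.laplacian_CLM_comp_left (l := Complex.ofRealCLM)).symm)

theorem hasCompactSupport_laplacian {η : 𝓢(E, ℝ)} (hη : HasCompactSupport η) :
    HasCompactSupport (Δ η : 𝓢(E, ℝ)) := by
  refine hη.mono' fun x hx => ?_
  by_contra h
  refine hx ?_
  rw [SchwartzMap.laplacian_eq_sum (stdOrthonormalBasis ℝ E), sum_apply]
  refine Finset.sum_eq_zero fun i _ => image_eq_zero_of_notMem_tsupport fun h' => h ?_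
  exact SchwartzMap.tsupport_lineDerivOp_subset _ _ (SchwartzMap.tsupport_lineDerivOp_subset _ _ h')

variable [MeasurableSpace E] [BorelSpace E]

/-- The functional `η ↦ ∫ η g` on Schwartz functions. -/
noncomputable def lpFunctional (g : Lp ℂ 2 (volume : Measure E)) : 𝓢(E, ℂ) →L[ℂ] ℂ :=
  (ContinuousLinearMap.lsmul ℂ ℂ).flip.lpPairing volume 2 2 g ∘L
    SchwartzMap.toLpCLM ℂ ℂ 2 volume

theorem lpFunctional_apply (g : Lp ℂ 2 (volume : Measure E)) (η : 𝓢(E, ℂ)) :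
    lpFunctional g η = ∫ x, η x • g x := by
  rw [lpFunctional, ContinuousLinearMap.comp_apply, SchwartzMap.toLpCLM_apply,
    ContinuousLinearMap.lpPairing_eq_integral]
  refine integral_congr_ae ?_
  filter_upwards [η.coeFn_toLp 2 volume] with x hx
  rw [hx]
  rfl

theorem lpFunctional_fourier (g : Lp ℂ 2 (volume : Measure E)) (θ : 𝓢(E, ℂ)) :
    lpFunctional g (𝓕 θ) = ∫ ξ, θ ξ • (𝓕 g : Lp ℂ 2 (volume : Measure E)) ξ := by
  rw [lpFunctional_apply, integral_fourier_smul_Lp]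

theorem lpFunctional_complexify (g : Lp ℂ 2 (volume : Measure E)) (η : 𝓢(E, ℝ)) :
    lpFunctional g (complexify η) = ∫ x, η x • g x := by
  simp [lpFunctional_apply, complexify_apply]

end Functional

section Tensor

theorem fderiv_tensor (η : 𝓢(Bdry d, ℝ)) (χ : 𝓢(ℝ, ℝ)) (p v : Bdry d × ℝ) :
    fderiv ℝ (fun p : Bdry d × ℝ => η p.1 * χ p.2) p v
      = (∂_{v.1} η : 𝓢(Bdry d, ℝ)) p.1 * χ p.2
        + η p.1 * (SchwartzMap.derivCLM ℝ ℝ χ p.2 * v.2) := by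
  have h1 : HasFDerivAt (fun p : Bdry d × ℝ => η p.1) _ p :=
    (η.differentiableAt (x := p.1)).hasFDerivAt.comp p hasFDerivAt_fst
  have h2 : HasFDerivAt (fun p : Bdry d × ℝ => χ p.2) _ p :=
    (χ.differentiableAt (x := p.2)).hasFDerivAt.comp p hasFDerivAt_snd
  rw [show (fun p : Bdry d × ℝ => η p.1 * χ p.2) = (fun p => η p.1) * fun p => χ p.2 from rfl,
    (h1.mul h2).fderiv, SchwartzMap.lineDerivOp_apply_eq_fderiv, SchwartzMap.derivCLM_apply]
  simp
  ring

theorem lap_tensor (η : 𝓢(Bdry d, ℝ)) (χ : 𝓢(ℝ, ℝ)) (p : Bdry d × ℝ) :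
    lap (fun p : Bdry d × ℝ => η p.1 * χ p.2) p
      = (Δ η : 𝓢(Bdry d, ℝ)) p.1 * χ p.2
        + η p.1 * SchwartzMap.derivCLM ℝ ℝ (SchwartzMap.derivCLM ℝ ℝ χ) p.2 := by
  rw [lap, SchwartzMap.laplacian_apply]
  congr 1
  · have := InnerProductSpace.laplacian_smul (χ p.2) ((η.smooth 2).contDiffAt (x := p.1))
    rw [smul_eq_mul, mul_comm] at this
    rw [← this, show (fun x => η x * χ p.2) = χ p.2 • ⇑η from funext fun x => mul_comm _ _]
  · have h1 : deriv (fun y => η p.1 * χ y) = fun y => η p.1 * SchwartzMap.derivCLM ℝ ℝ χ y := by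
      ext y
      rw [deriv_const_mul _ χ.differentiableAt, SchwartzMap.derivCLM_apply]
    rw [iteratedDeriv_succ, iteratedDeriv_one, h1,
      deriv_const_mul _ (SchwartzMap.differentiableAt _), ← SchwartzMap.derivCLM_apply ℝ]

end Tensor

section LapPow

theorem iterate_apply_smul (T : 𝓢(ℝ, ℝ) →L[ℝ] 𝓢(ℝ, ℝ)) (k : ℕ) (c : ℝ) (χ : 𝓢(ℝ, ℝ)) :
    T^[k] (c • χ) = c • T^[k] χ :=
  Function.Commute.iterate_left (f := T) (g := (c • ·)) (fun χ => map_smul T c χ) k χ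

/-- The distribution `(Δ_x + ∂_y²)^k U`, tested against a fixed function of `y`. -/
noncomputable def lapFunctional (U : Bdry d × ℝ → ℂ) : ℕ → 𝓢(ℝ, ℝ) → 𝓢(Bdry d, ℂ) →L[ℂ] ℂ
  | 0, χ => lpFunctional (slice χ U)
  | k + 1, χ => lapFunctional U k χ ∘L LineDeriv.laplacianCLM ℂ (Bdry d) 𝓢(Bdry d, ℂ)
      + lapFunctional U k (SchwartzMap.derivCLM ℝ ℝ (SchwartzMap.derivCLM ℝ ℝ χ))

theorem lapTest_add {Ω : Opens (Bdry d × ℝ)} (φ ψ : 𝓓(Ω, ℝ)) :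
    lapTest (φ + ψ) = lapTest φ + lapTest ψ := by
  have h : ∀ (v : Bdry d × ℝ) (φ ψ : 𝓓(Ω, ℝ)),
      (∂_{v} (φ + ψ) : 𝓓(Ω, ℝ)) = ∂_{v} φ + ∂_{v} ψ := fun v φ ψ => LineDeriv.lineDerivOp_add v φ ψ
  simp only [lapTest, h, Finset.sum_add_distrib]
  abel

theorem lapTest_iterate_add {Ω : Opens (Bdry d × ℝ)} (k : ℕ) : ∀ φ ψ : 𝓓(Ω, ℝ),
    lapTest^[k] (φ + ψ) = lapTest^[k] φ + lapTest^[k] ψ := by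
  induction k with
  | zero => intro φ ψ; rfl
  | succ k ih => intro φ ψ; simp only [Function.iterate_succ_apply, lapTest_add, ih]

/-- The Laplacian of a product is a sum of two products of the same kind, matching the recursion of
`lapFunctional`. -/
theorem integral_lap_iterate_tensor {U : Bdry d × ℝ → ℂ}
    (hU : MemLp U 2 (volume.restrict (upper d : Set (Bdry d × ℝ)))) (k : ℕ) :
    ∀ {η : 𝓢(Bdry d, ℝ)} {χ : 𝓢(ℝ, ℝ)} (φ : 𝓓(upper d, ℝ)), HasCompactSupport η →
      χ ∈ halfLineTest → (⇑φ = fun p => η p.1 * χ p.2) →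
      ∫ p in upper d, (lap^[k] φ) p • U p = lapFunctional U k χ (complexify η) := by
  induction k with
  | zero =>
    intro η χ φ hη hχ hφ
    rw [lapFunctional, lpFunctional_complexify, ← (integral_tensor hU hη hχ.1).2]
    simp [hφ]
  | succ k ih =>
    intro η χ φ hη hχ hφ
    have hsub : ∀ (η : 𝓢(Bdry d, ℝ)) {χ : 𝓢(ℝ, ℝ)}, χ ∈ halfLineTest →
        tsupport η ×ˢ tsupport χ ⊆ (upper d : Set (Bdry d × ℝ)) := fun η χ h p hp => h.2 hp.2
    have hχ' := derivCLM_mem_halfLineTest (derivCLM_mem_halfLineTest hχ)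
    have hη' := hasCompactSupport_laplacian hη
    obtain ⟨φ₁, h₁⟩ := exists_tensor_test hη' hχ.1 (hsub _ hχ)
    obtain ⟨φ₂, h₂⟩ := exists_tensor_test hη hχ'.1 (hsub _ hχ')
    have e : lapTest φ = φ₁ + φ₂ := by
      ext p
      rw [coe_lapTest, hφ, lap_tensor, add_apply, h₁, h₂]
    have hl := fun φ : 𝓓(upper d, ℝ) => integrable_test_smul (locallyIntegrableOn_upper hU) φ
    rw [Function.iterate_succ_apply, ← coe_lapTest, e, ← coe_lapTest_iterate, lapTest_iterate_add]
    simp only [add_apply, add_smul]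
    rw [integral_add (hl _) (hl _), coe_lapTest_iterate, coe_lapTest_iterate,
      ih φ₁ hη' hχ (funext h₁), ih φ₂ hη hχ' (funext h₂), lapFunctional,
      add_apply, ContinuousLinearMap.comp_apply, complexify_laplacian, SchwartzMap.laplacianCLM_eq]

theorem lapFunctional_eq {U W : Bdry d × ℝ → ℂ} {k : ℕ} (h : HasWeakLapPow k U W)
    (hU : MemLp U 2 (volume.restrict (upper d : Set (Bdry d × ℝ))))
    (hW : MemLp W 2 (volume.restrict (upper d : Set (Bdry d × ℝ)))) {χ : 𝓢(ℝ, ℝ)}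
    (hχ : χ ∈ halfLineTest) : lapFunctional U k χ = lpFunctional (slice χ W) := by
  ext η
  refine sub_eq_zero.1 (eq_zero_of_forall_real_test
    (T := lapFunctional U k χ - lpFunctional (slice χ W)) (fun η hη => ?_) η)
  obtain ⟨φ, hφ⟩ := exists_tensor_test (Ω := upper d) hη hχ.1 fun p hp => hχ.2 hp.2
  change lapFunctional U k χ (complexify η) - lpFunctional (slice χ W) (complexify η) = 0
  rw [← integral_lap_iterate_tensor hU k φ hη hχ (funext hφ), h.2 φ, lpFunctional_complexify,
    ← (integral_tensor hW hη hχ.1).2]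
  simp [hφ]

theorem locallyIntegrable_Lp {E G : Type*} [NormedAddCommGroup E] [InnerProductSpace ℝ E]
    [FiniteDimensional ℝ E] [MeasurableSpace E] [BorelSpace E] [NormedAddCommGroup G]
    (g : Lp G 2 (volume : Measure E)) : LocallyIntegrable g :=
  (Lp.memLp g).locallyIntegrable (by norm_num)

theorem integrable_schwartz_smul_locallyIntegrable {E : Type*} [NormedAddCommGroup E]
    [InnerProductSpace ℝ E] [FiniteDimensional ℝ E] [MeasurableSpace E] [BorelSpace E] {g : E → ℂ}
    (hg : LocallyIntegrable g) {θ : 𝓢(E, ℂ)} (hθ : HasCompactSupport θ) :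
    Integrable fun x => θ x • g x :=
  hg.integrable_smul_left_of_hasCompactSupport θ.continuous hθ

/-- Under the transform `Δ_x` becomes `-(2π‖ξ‖)²`, so the recursion of `lapFunctional` turns into
that of `modeLap`. The multiplier is unbounded, so only local integrability survives the induction
and `θ` has compact support. -/
theorem lapFunctional_fourier (U : Bdry d × ℝ → ℂ) (k : ℕ) : ∀ χ : 𝓢(ℝ, ℝ),
    LocallyIntegrable (fun ξ => pair ((modeLap (2 * Real.pi * ‖ξ‖))^[k] χ) (fiberFourier U ξ)) ∧
      ∀ θ : 𝓢(Bdry d, ℂ), HasCompactSupport θ → lapFunctional U k χ (𝓕 θ)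
        = ∫ ξ, θ ξ • pair ((modeLap (2 * Real.pi * ‖ξ‖))^[k] χ) (fiberFourier U ξ) := by
  induction k with
  | zero =>
    intro χ
    have := fourier_slice χ U
    refine ⟨(locallyIntegrable_Lp _).congr this, fun θ hθ => ?_⟩
    rw [lapFunctional, lpFunctional_fourier]
    refine integral_congr_ae ?_
    filter_upwards [this] with ξ hξ
    rw [hξ]
    rfl
  | succ k ih =>
    intro χ
    set χ' := SchwartzMap.derivCLM ℝ ℝ (SchwartzMap.derivCLM ℝ ℝ χ) with hχ'
    have hit : ∀ l : ℝ, (modeLap l)^[k + 1] χ = (modeLap l)^[k] χ' - l ^ 2 • (modeLap l)^[k] χ := by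
      intro l
      rw [Function.iterate_succ_apply, modeLap_def, ← hχ', iterate_map_sub, iterate_apply_smul]
    have hp : ∀ ξ : Bdry d, pair ((modeLap (2 * Real.pi * ‖ξ‖))^[k + 1] χ) (fiberFourier U ξ)
        = pair ((modeLap (2 * Real.pi * ‖ξ‖))^[k] χ') (fiberFourier U ξ)
          + ((-(2 * Real.pi * ‖ξ‖) ^ 2 : ℝ) : ℂ) •
            pair ((modeLap (2 * Real.pi * ‖ξ‖))^[k] χ) (fiberFourier U ξ) := by
      intro ξ
      rw [hit, pair_sub, pair_smul]
      simp [sub_eq_add_neg]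
    simp only [hp]
    have hcont : Continuous fun ξ : Bdry d => ((-(2 * Real.pi * ‖ξ‖) ^ 2 : ℝ) : ℂ) := by fun_prop
    refine ⟨(ih χ').1.add ((ih χ).1.continuous_smul hcont), fun θ hθ => ?_⟩
    obtain ⟨θ', hθ', hΔ⟩ := exists_laplacian_fourier θ
    have hcθ' : HasCompactSupport θ' := hθ.mono fun ξ hξ h0 => hξ (by rw [hθ', h0, mul_zero])
    rw [lapFunctional, add_apply, ContinuousLinearMap.comp_apply, SchwartzMap.laplacianCLM_eq, hΔ,
      (ih χ).2 θ' hcθ', (ih χ').2 θ hθ,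
      ← integral_add (integrable_schwartz_smul_locallyIntegrable (ih χ).1 hcθ')
        (integrable_schwartz_smul_locallyIntegrable (ih χ').1 hθ)]
    refine integral_congr_ae (.of_forall fun ξ => ?_)
    simp only [hθ', smul_eq_mul]
    ring

theorem ae_pair_modeLap_iterate {U W : Bdry d × ℝ → ℂ} {k : ℕ} (h : HasWeakLapPow k U W)
    (hU : MemLp U 2 (volume.restrict (upper d : Set (Bdry d × ℝ))))
    (hW : MemLp W 2 (volume.restrict (upper d : Set (Bdry d × ℝ)))) {χ : 𝓢(ℝ, ℝ)}
    (hχ : χ ∈ halfLineTest) : ∀ᵐ ξ,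
      pair ((modeLap (2 * Real.pi * ‖ξ‖))^[k] χ) (fiberFourier U ξ)
        - pair χ (fiberFourier W ξ) = 0 := by
  obtain ⟨hl, hi⟩ := lapFunctional_fourier U k χ
  have hl' := (locallyIntegrable_Lp _).congr (fourier_slice χ W)
  refine ae_eq_zero_of_forall_schwartz (hl.sub hl') fun θ hθ => ?_
  simp only [smul_sub]
  rw [integral_sub (integrable_schwartz_smul_locallyIntegrable hl hθ)
    (integrable_schwartz_smul_locallyIntegrable hl' hθ), ← hi θ hθ, lapFunctional_eq h hU hW hχ,
    lpFunctional_fourier, sub_eq_zero]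
  refine integral_congr_ae ?_
  filter_upwards [fourier_slice χ W] with ξ hξ
  rw [hξ]

/-- The operator of `ℕ`-indexed sequences that models `modeLap` on the sequence of derivatives. -/
noncomputable def seqLap (l : ℝ) (s : ℕ → HalfLineL2) : ℕ → HalfLineL2 :=
  fun i => s (i + 2) - (l ^ 2) • s i

/-- The sequence of derivatives of a Schwartz function, restricted to the half line. -/
noncomputable def derivSeq (χ : 𝓢(ℝ, ℝ)) (i : ℕ) : HalfLineL2 :=
  toHalfLine ((SchwartzMap.derivCLM ℝ ℝ)^[i] χ)

theorem derivSeq_modeLap (l : ℝ) (χ : 𝓢(ℝ, ℝ)) :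
    derivSeq (modeLap l χ) = seqLap l (derivSeq χ) := by
  funext i
  rw [seqLap, derivSeq, derivSeq, derivSeq, modeLap_def, iterate_map_sub,
    iterate_apply_smul, map_sub, map_smul, Function.iterate_add_apply]
  rfl

/-- The exceptional null set must not depend on `χ`. The operator is not continuous for the `L²`
norm, but on sequences of derivatives in the second countable space `ℕ → HalfLineL2` it acts
continuously as `seqLap`. -/
theorem ae_forall_pair_modeLap_iterate {U W : Bdry d × ℝ → ℂ} {k : ℕ} (h : HasWeakLapPow k U W)
    (hU : MemLp U 2 (volume.restrict (upper d : Set (Bdry d × ℝ))))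
    (hW : MemLp W 2 (volume.restrict (upper d : Set (Bdry d × ℝ)))) : ∀ᵐ ξ, ∀ χ ∈ halfLineTest,
      pair ((modeLap (2 * Real.pi * ‖ξ‖))^[k] χ) (fiberFourier U ξ)
        = pair χ (fiberFourier W ξ) := by
  have hit : ∀ (l : ℝ) (χ : 𝓢(ℝ, ℝ)), (seqLap l)^[k] (derivSeq χ) = derivSeq ((modeLap l)^[k] χ) :=
    fun l χ => ((Function.Semiconj.iterate_right (f := derivSeq) (ga := modeLap l)
      (gb := seqLap l) (fun χ => derivSeq_modeLap l χ) k) χ).symm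
  have hc : ∀ l : ℝ, Continuous (seqLap l) := fun l => by
    unfold seqLap
    fun_prop
  have := ae_forall_of_forall_ae (μ := (volume : Measure (Bdry d))) (K := ℂ)
    (fun χ : halfLineTest => derivSeq χ)
    (fun ξ s => inner ℂ (((seqLap (2 * Real.pi * ‖ξ‖))^[k] s) 0) (fiberFourier U ξ)
      - inner ℂ (s 0) (fiberFourier W ξ))
    (fun ξ => by
      have := (hc (2 * Real.pi * ‖ξ‖)).iterate k
      fun_prop)
    (fun χ => by
      filter_upwards [ae_pair_modeLap_iterate h hU hW χ.2] with ξ hξ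
      rw [hit]
      exact hξ)
  filter_upwards [this] with ξ hξ χ hχ
  have := hξ ⟨χ, hχ⟩
  rw [hit] at this
  exact sub_eq_zero.1 this

end LapPow

end HalfSpace

/-! ### Traces, tangential derivatives and boundary data on the frequency side. -/

namespace HalfSpace

open Set Filter
open scoped Distributions FourierTransform Laplacian SchwartzMap LineDeriv ContDiff

variable {d : ℕ}

section Trace

theorem fourier_add_add {E : Type*} [NormedAddCommGroup E] [InnerProductSpace ℝ E]
    [FiniteDimensional ℝ E] [MeasurableSpace E] [BorelSpace E]
    {a b g : Lp ℂ 2 (volume : Measure E)} {c : ℝ} (h : ∀ᵐ x, a x + b x + c • g x = 0) :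
    ∀ᵐ ξ, (𝓕 a : Lp ℂ 2 (volume : Measure E)) ξ + (𝓕 b : Lp ℂ 2 (volume : Measure E)) ξ
      + c • (𝓕 g : Lp ℂ 2 (volume : Measure E)) ξ = 0 := by
  have h0 : a + b + (c : ℂ) • g = 0 := by
    refine Lp.ext ?_
    filter_upwards [h, Lp.coeFn_add (a + b) ((c : ℂ) • g), Lp.coeFn_add a b,
      Lp.coeFn_smul (c : ℂ) g, Lp.coeFn_zero ℂ 2 (volume : Measure E)] with x h1 h2 h3 h4 h5
    rw [h2, Pi.add_apply, h3, Pi.add_apply, h4, Pi.smul_apply, h5]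
    simpa using h1
  have h1 : 𝓕 a + 𝓕 b + (c : ℂ) • 𝓕 g = (0 : Lp ℂ 2 (volume : Measure E)) := by
    rw [← FourierTransform.fourier_smul, ← FourierTransform.fourier_add,
      ← FourierTransform.fourier_add, h0]
    exact FourierTransform.fourier_zero ..
  filter_upwards [Lp.coeFn_add (𝓕 a + 𝓕 b) ((c : ℂ) • 𝓕 g), Lp.coeFn_add (𝓕 a) (𝓕 b),
      Lp.coeFn_smul (c : ℂ) (𝓕 g), Lp.coeFn_zero ℂ 2 (volume : Measure E)] with x h2 h3 h4 h5
  rw [h1, h5, Pi.add_apply, h3, Pi.add_apply, h4, Pi.smul_apply] at h2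
  simpa using h2.symm

/-- Product test functions turn the Green formula defining the trace into an identity between `L²`
functions of `x`, which is then Fourier transformed. -/
theorem ae_trace {W : Bdry d × ℝ → ℂ} {γ : Bdry d → ℂ} (h : HasTrace W γ)
    {g : Lp ℂ 2 (volume : Measure (Bdry d))} {c : ℝ} (hγ : ∀ᵐ x, γ x = c • g x) {χ : 𝓢(ℝ, ℝ)}
    (hχ : HasCompactSupport χ) : ∀ᵐ ξ,
      pair (SchwartzMap.derivCLM ℝ ℝ χ) (fiberFourier W ξ)
        + pair χ (fiberFourier (weakDeriv (ey d) W) ξ)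
        + χ 0 • (c • (𝓕 g : Lp ℂ 2 (volume : Measure (Bdry d))) ξ) = 0 := by
  obtain ⟨hW, hγ2, hT⟩ := h
  have hZ := hW.memLp_weakDeriv (n := 0) (ey d)
  have hχ' := hasCompactSupport_deriv hχ
  have hγi := (locallyIntegrable_Lp g).smul (χ 0 * c)
  have h0 : ∀ᵐ x, slice (SchwartzMap.derivCLM ℝ ℝ χ) W x + slice χ (weakDeriv (ey d) W) x
      + (χ 0 * c) • g x = 0 := by
    refine ae_eq_zero_of_integral_contDiff_smul_eq_zero
      (((locallyIntegrable_Lp _).add (locallyIntegrable_Lp _)).add hγi) fun η hs hc => ?_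
    set η' : 𝓢(Bdry d, ℝ) := hc.toSchwartzMap hs with hη'
    have hη : HasCompactSupport η' := hc
    obtain ⟨φ, hφ⟩ := exists_tensor_test (Ω := ⊤) hη hχ fun _ _ => trivial
    have hφ' : (φ : Bdry d × ℝ → ℝ) = fun p => η' p.1 * χ p.2 := funext hφ
    have e := hT φ
    have hdir : ∀ p, fderiv ℝ φ p (ey d) = η' p.1 * SchwartzMap.derivCLM ℝ ℝ χ p.2 := by
      intro p
      rw [hφ', fderiv_tensor]
      simp [ey]
    obtain ⟨i1, e1⟩ := integral_tensor hW.memLp hη hχ'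
    obtain ⟨i2, e2⟩ := integral_tensor hZ hη hχ
    simp only [hdir, hφ] at e
    rw [integral_add i1 i2, e1, e2] at e
    have hi : ∀ G : Bdry d → ℂ, LocallyIntegrable G → Integrable fun x => η' x • G x := fun G hG =>
      hG.integrable_smul_left_of_hasCompactSupport η'.continuous hη
    have e3 : ∫ x, (η' x * χ 0) • γ x = ∫ x, η' x • ((χ 0 * c) • g x) := by
      refine integral_congr_ae ?_
      filter_upwards [hγ] with x hx
      rw [hx, smul_smul, smul_smul, mul_assoc]
    rw [e3] at e
    change ∫ x, η' x • _ = 0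
    simp only [smul_add]
    have i3 := hi _ (locallyIntegrable_Lp (slice (SchwartzMap.derivCLM ℝ ℝ χ) W))
    have i4 := hi _ (locallyIntegrable_Lp (slice χ (weakDeriv (ey d) W)))
    have e4 := integral_add (i3.add i4) (hi _ hγi)
    simp only [Pi.add_apply, Pi.smul_apply] at e4
    rw [e4, integral_add i3 i4, e, neg_add_cancel]
  filter_upwards [fourier_add_add h0, fourier_slice (SchwartzMap.derivCLM ℝ ℝ χ) W,
    fourier_slice χ (weakDeriv (ey d) W)] with ξ h1 h2 h3
  rw [← h2, ← h3, smul_smul]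
  exact h1

/-- The value `χ 0` is not continuous in the `L²` norm, so it is recorded as a separate coordinate
of the separable parameter space. -/
theorem ae_forall_trace {W : Bdry d × ℝ → ℂ} {γ : Bdry d → ℂ} (h : HasTrace W γ)
    {g : Lp ℂ 2 (volume : Measure (Bdry d))} {c : ℝ} (hγ : ∀ᵐ x, γ x = c • g x) :
    ∀ᵐ ξ, ∀ χ : 𝓢(ℝ, ℝ), HasCompactSupport χ →
      pair (SchwartzMap.derivCLM ℝ ℝ χ) (fiberFourier W ξ)
        + pair χ (fiberFourier (weakDeriv (ey d) W) ξ)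
        = -(χ 0 • (c • (𝓕 g : Lp ℂ 2 (volume : Measure (Bdry d))) ξ)) := by
  have := ae_forall_of_forall_ae (μ := (volume : Measure (Bdry d))) (K := ℂ)
    (fun χ : {χ : 𝓢(ℝ, ℝ) // HasCompactSupport χ} =>
      (toHalfLine (SchwartzMap.derivCLM ℝ ℝ χ), toHalfLine (χ : 𝓢(ℝ, ℝ)), (χ : 𝓢(ℝ, ℝ)) 0))
    (fun ξ s => inner ℂ s.1 (fiberFourier W ξ)
      + inner ℂ s.2.1 (fiberFourier (weakDeriv (ey d) W) ξ)
      + s.2.2 • (c • (𝓕 g : Lp ℂ 2 (volume : Measure (Bdry d))) ξ))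
    (fun ξ => by fun_prop) (fun χ => ae_trace h hγ χ.2)
  filter_upwards [this] with ξ hξ χ hχ
  exact eq_neg_of_add_eq_zero_left (hξ ⟨χ, hχ⟩)

end Trace

section Tangential

theorem ae_pair_tangential {W X : Bdry d × ℝ → ℂ} {i : Fin d} (h : HasWeakDeriv (ex i) W X)
    (hW : MemLp W 2 (volume.restrict (upper d : Set (Bdry d × ℝ))))
    (hX : MemLp X 2 (volume.restrict (upper d : Set (Bdry d × ℝ)))) {χ : 𝓢(ℝ, ℝ)}
    (hχ : χ ∈ halfLineTest) : ∀ᵐ ξ : Bdry d,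
      pair χ (fiberFourier X ξ) - (2 * Real.pi * Complex.I * ξ i) • pair χ (fiberFourier W ξ)
        = 0 := by
  set v : Bdry d := EuclideanSpace.single i 1 with hv
  have hT : ∀ η : 𝓢(Bdry d, ℂ),
      lpFunctional (slice χ W) (∂_{v} η) + lpFunctional (slice χ X) η = 0 := by
    refine eq_zero_of_forall_real_test (T := lpFunctional (slice χ W) ∘L
      LineDeriv.lineDerivOpCLM ℂ 𝓢(Bdry d, ℂ) v + lpFunctional (slice χ X)) fun η hη => ?_
    change lpFunctional (slice χ W) (∂_{v} (complexify η))
      + lpFunctional (slice χ X) (complexify η) = 0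
    obtain ⟨φ, hφ⟩ := exists_tensor_test (Ω := upper d) hη hχ.1 fun p hp => hχ.2 hp.2
    have hφ' : (φ : Bdry d × ℝ → ℝ) = fun p => η p.1 * χ p.2 := funext hφ
    have hdir : ∀ p, fderiv ℝ φ p (ex i) = (∂_{v} η : 𝓢(Bdry d, ℝ)) p.1 * χ p.2 := by
      intro p
      rw [hφ', fderiv_tensor]
      simp [ex, hv]
    rw [← complexify_lineDeriv, lpFunctional_complexify, lpFunctional_complexify,
      ← (integral_tensor hW (hasCompactSupport_lineDeriv hη v) hχ.1).2,
      ← (integral_tensor hX hη hχ.1).2]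
    have := h.2 φ
    simp only [hdir, hφ] at this
    rw [this, neg_add_cancel]
  have hc : Continuous fun ξ : Bdry d => 2 * Real.pi * Complex.I * (ξ i : ℂ) := by fun_prop
  have hWl := ((locallyIntegrable_Lp (𝓕 (slice χ W))).continuous_smul hc)
  have hXl := locallyIntegrable_Lp (𝓕 (slice χ X))
  have h0 := ae_eq_zero_of_forall_schwartz (hXl.sub hWl) fun θ hθ => by
    obtain ⟨θ', hθ', hd⟩ := exists_lineDeriv_fourier θ v
    have e := hT (𝓕 θ)
    rw [hd, lpFunctional_fourier, lpFunctional_fourier] at e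
    simp only [Pi.sub_apply, smul_sub]
    rw [integral_sub (integrable_schwartz_smul_locallyIntegrable hXl hθ)
      (integrable_schwartz_smul_locallyIntegrable hWl hθ), ← e, add_comm, ← sub_neg_eq_add,
      ← integral_neg]
    congr 1
    refine integral_congr_ae (.of_forall fun ξ => ?_)
    have hin : inner ℝ ξ v = ξ i := by simp [hv, EuclideanSpace.inner_single_right]
    simp only [hθ', hin, smul_eq_mul]
    ring
  filter_upwards [h0, fourier_slice χ W, fourier_slice χ X] with ξ h1 h2 h3
  rw [← h2, ← h3]
  exact h1

theorem ae_fiberFourier_tangential {W X : Bdry d × ℝ → ℂ} {i : Fin d}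
    (h : HasWeakDeriv (ex i) W X)
    (hW : MemLp W 2 (volume.restrict (upper d : Set (Bdry d × ℝ))))
    (hX : MemLp X 2 (volume.restrict (upper d : Set (Bdry d × ℝ)))) : ∀ᵐ ξ : Bdry d,
      fiberFourier X ξ = (2 * Real.pi * Complex.I * ξ i) • fiberFourier W ξ := by
  have := ae_forall_of_forall_ae (μ := (volume : Measure (Bdry d))) (K := ℂ)
    (fun χ : halfLineTest => toHalfLine (χ : 𝓢(ℝ, ℝ)))
    (fun ξ s => inner ℂ s (fiberFourier X ξ)
      - (2 * Real.pi * Complex.I * ξ i) • inner ℂ s (fiberFourier W ξ))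
    (fun ξ => by fun_prop) (fun χ => ae_pair_tangential h hW hX χ.2)
  filter_upwards [this] with ξ hξ
  refine ext_of_forall_halfLineTest fun χ hχ => ?_
  rw [map_smul]
  exact sub_eq_zero.1 (hξ ⟨χ, hχ⟩)

end Tangential

section Boundary

theorem ae_fourier_bdryLapPow {k : ℕ} {u g : Lp ℂ 2 (volume : Measure (Bdry d))}
    (h : IsBdryLapPow k u g) : ∀ᵐ ξ,
      (𝓕 g : Lp ℂ 2 (volume : Measure (Bdry d))) ξ
        = (-(2 * Real.pi * ‖ξ‖) ^ 2) ^ k • (𝓕 u : Lp ℂ 2 (volume : Measure (Bdry d))) ξ := by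
  have hk : ∀ (k : ℕ) (T : 𝓢'(Bdry d, ℂ)) (θ : 𝓢(Bdry d, ℂ)), HasCompactSupport θ →
      ∃ θ' : 𝓢(Bdry d, ℂ), HasCompactSupport θ' ∧
        (∀ ξ, θ' ξ = (-(2 * Real.pi * ‖ξ‖) ^ 2) ^ k • θ ξ) ∧
        ((fun T : 𝓢'(Bdry d, ℂ) => Δ T)^[k] T) (𝓕 θ) = T (𝓕 θ') := by
    intro k
    induction k with
    | zero => intro T θ hθ; exact ⟨θ, hθ, fun ξ => by simp, rfl⟩
    | succ k ih =>
      intro T θ hθ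
      obtain ⟨θ₁, hc₁, h₁, e₁⟩ := ih (Δ T) θ hθ
      obtain ⟨θ₂, h₂, e₂⟩ := exists_laplacian_fourier θ₁
      refine ⟨θ₂, hc₁.mono fun ξ hξ h0 => hξ (by rw [h₂, h0, mul_zero]), fun ξ => ?_, ?_⟩
      · rw [h₂, h₁, pow_succ' _ k, ← smul_smul, ← Complex.real_smul]
      · rw [Function.iterate_succ_apply, e₁, TemperedDistribution.laplacian_apply_apply, e₂]
  have hc : Continuous fun ξ : Bdry d => (-(2 * Real.pi * ‖ξ‖) ^ 2) ^ k := by fun_prop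
  have hgl := locallyIntegrable_Lp (𝓕 g)
  have hul := (locallyIntegrable_Lp (𝓕 u)).continuous_smul hc
  have h0 := ae_eq_zero_of_forall_schwartz (hgl.sub hul) fun θ hθ => by
    obtain ⟨θ', -, hθ', e⟩ := hk k (Lp.toTemperedDistribution u) θ hθ
    rw [IsBdryLapPow] at h
    rw [h, Lp.toTemperedDistribution_apply, Lp.toTemperedDistribution_apply,
      integral_fourier_smul_Lp, integral_fourier_smul_Lp] at e
    simp only [Pi.sub_apply, smul_sub]
    rw [integral_sub (integrable_schwartz_smul_locallyIntegrable hgl hθ)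
      (integrable_schwartz_smul_locallyIntegrable hul hθ), e, sub_eq_zero]
    refine integral_congr_ae (.of_forall fun ξ => ?_)
    simp only [hθ', smul_eq_mul, Complex.real_smul]
    ring
  filter_upwards [h0] with ξ hξ
  exact sub_eq_zero.1 hξ

end Boundary

end HalfSpace

/-! ### The energy identity at almost every frequency, and Plancherel. -/

namespace HalfSpace

open Set Filter
open scoped Distributions FourierTransform Laplacian SchwartzMap LineDeriv ContDiff

variable {d : ℕ}

section Energy

/-- The energy identity for one frequency. -/
theorem mode_energy {l : ℝ} (hl : 0 < l) {m : ℕ} (hm : 1 ≤ m) (a : ℂ) {w z y : ℕ → HalfLineL2}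
    (h0 : ∀ χ ∈ halfLineTest, pair ((modeLap l)^[m] χ) (w 0) = 0)
    (h1 : ∀ k, 2 * k ≤ m → ∀ χ ∈ halfLineTest, pair ((modeLap l)^[k] χ) (w 0) = pair χ (w k))
    (h2 : ∀ k, 2 * k + 1 ≤ m → ∀ χ : 𝓢(ℝ, ℝ), HasCompactSupport χ →
      pair (SchwartzMap.derivCLM ℝ ℝ χ) (w k) + pair χ (z k) = -(χ 0 •
        (Real.Gamma m * Real.Gamma ((m : ℝ) - 1 / 2 - k) /
          (Real.Gamma ((m : ℝ) - k) * Real.Gamma ((m : ℝ) - 1 / 2))) • ((-l ^ 2) ^ k • a)))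
    (h3 : ∀ k, 2 * k + 2 ≤ m → ∀ χ : 𝓢(ℝ, ℝ), HasCompactSupport χ →
      pair (SchwartzMap.derivCLM ℝ ℝ χ) (z k) + pair χ (y k) = 0) :
    (if Even m then ‖w (m / 2)‖ ^ 2 else l ^ 2 * ‖w (m / 2)‖ ^ 2 + ‖z (m / 2)‖ ^ 2)
      = Real.Gamma m * Real.Gamma (1 / 2) / Real.Gamma ((m : ℝ) - 1 / 2) * l ^ (2 * m - 1)
        * ‖a‖ ^ 2 := by
  have hL : ∀ (L : ℂ →L[ℝ] ℝ) (f : HalfLineL2),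
      MemLp (fun t => L (f t)) 2 (volume.restrict (Ioi 0)) :=
    fun L f => L.comp_memLp' (Lp.memLp f)
  have hsum : ∀ (L : ℂ →L[ℝ] ℝ) (χ ψ : 𝓢(ℝ, ℝ)) (f g : HalfLineL2),
      ∫ t in Ioi 0, (ψ t * L (f t) + χ t * L (g t)) = L (pair ψ f + pair χ g) := by
    intro L χ ψ f g
    rw [integral_add (integrable_schwartz_mul_memLp ψ (hL L f))
      (integrable_schwartz_mul_memLp χ (hL L g)), map_add, clm_pair, clm_pair]
  -- All conditions are real-linear, so the real-valued half-line identity applies to real and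
  -- imaginary parts; the two are added at the end.
  have key : ∀ L : ℂ →L[ℝ] ℝ, _ := fun L => halfLine_energy hl hm (L a)
    (w := fun k t => L (w k t)) (z := fun k t => L (z k t)) (y := fun k t => L (y k t))
    (fun k _ => hL L _) (fun k _ => hL L _) (fun k _ => hL L _)
    (fun χ hχ => by rw [← clm_pair, h0 χ hχ, map_zero])
    (fun k hk χ hχ => by rw [← clm_pair, ← clm_pair, h1 k hk χ hχ])
    (fun k hk χ hχ => by
      have := hsum L χ (SchwartzMap.derivCLM ℝ ℝ χ) (w k) (z k)
      simp only [SchwartzMap.derivCLM_apply] at this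
      rw [this, h2 k hk χ hχ]
      simp only [map_neg, map_smul, smul_eq_mul, mul_assoc])
    (fun k hk χ hχ => by
      have := hsum L χ (SchwartzMap.derivCLM ℝ ℝ χ) (z k) (y k)
      simp only [SchwartzMap.derivCLM_apply] at this
      rw [this, h3 k hk χ hχ, map_zero])
  have hre := key Complex.reCLM
  have him := key Complex.imCLM
  simp only [Complex.reCLM_apply, Complex.imCLM_apply] at hre him
  rw [← Complex.normSq_eq_norm_sq a, Complex.normSq_apply]
  simp only [norm_sq_halfLine]
  split_ifs at hre him ⊢ <;> linear_combination hre + him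

theorem fiberFourier_zero : fiberFourier (0 : Bdry d × ℝ → ℂ) = 0 := by
  have : fiber (0 : Bdry d × ℝ → ℂ) = 0 := by
    refine Lp.ext ?_
    filter_upwards [coe_fiber (d := d) (f := 0) MemLp.zero,
      Lp.coeFn_zero HalfLineL2 2 (volume : Measure (Bdry d))] with x h1 h2
    rw [h2]
    refine Lp.ext (h1.trans ?_)
    filter_upwards [Lp.coeFn_zero ℂ 2 (volume.restrict (Ioi (0 : ℝ)))] with t ht
    exact ht.symm
  rw [fiberFourier, this]
  exact FourierTransform.fourier_zero ..

/-- Plancherel for the energy. The tangential derivatives become factors `2πi ξ_i`, whose squared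
moduli sum to `(2π‖ξ‖)²`. The integrable density `G` is kept because it later places `u` in the
domain of `fracLap`. -/
theorem integrable_gradPowSq {m : ℕ} {U : Bdry d × ℝ → ℂ} (hU : MemW m U)
    (h1 : ∀ k, 2 * k + 1 ≤ m → MemW 1 (weakLapPow k U)) :
    IntegrableOn (gradPowSq m U) (upper d : Set (Bdry d × ℝ)) ∧ ∃ G : Bdry d → ℝ, Integrable G ∧
      ∫ p in upper d, gradPowSq m U p = ∫ ξ, G ξ ∧
      ∀ᵐ ξ, G ξ = if Even m then ‖fiberFourier (weakLapPow (m / 2) U) ξ‖ ^ 2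
        else (2 * Real.pi * ‖ξ‖) ^ 2 * ‖fiberFourier (weakLapPow (m / 2) U) ξ‖ ^ 2
          + ‖fiberFourier (weakDeriv (ey d) (weakLapPow (m / 2) U)) ξ‖ ^ 2 := by
  have hsq : ∀ {f : Bdry d × ℝ → ℂ}, MemLp f 2 (volume.restrict (upper d : Set (Bdry d × ℝ))) →
      IntegrableOn (fun p => ‖f p‖ ^ 2) (upper d : Set (Bdry d × ℝ)) :=
    fun hf => (memLp_two_iff_integrable_sq_norm hf.1).1 hf
  set W := weakLapPow (m / 2) U with hWdef
  rcases Nat.even_or_odd m with he | ho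
  · have hm := Nat.two_mul_div_two_of_even he
    have hW := (hU.weakLapPow (n := 0) (k := m / 2) (by omega)).2
    have hg : gradPowSq m U = fun p => ‖W p‖ ^ 2 := by
      funext p
      rw [gradPowSq, if_pos he]
    rw [hg]
    exact ⟨hsq hW, _, integrable_norm_sq_fiberFourier W, integral_norm_sq_upper hW,
      .of_forall fun ξ => by rw [if_pos he]⟩
  · have hne := Nat.not_even_iff_odd.2 ho
    have hW := h1 (m / 2) (by have := Nat.two_mul_div_two_add_one_of_odd ho; omega)
    rw [← hWdef] at hW
    have hZ := hW.memLp_weakDeriv (n := 0) (ey d)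
    have hX := fun i : Fin d => hW.memLp_weakDeriv (n := 0) (ex i)
    have hg : gradPowSq m U = fun p => (∑ i : Fin d, ‖weakDeriv (ex i) W p‖ ^ 2)
        + ‖weakDeriv (ey d) W p‖ ^ 2 := by
      funext p
      rw [gradPowSq, if_neg hne]
    rw [hg]
    have hXi := integrable_finsetSum Finset.univ fun i _ => hsq (hX i)
    refine ⟨hXi.add (hsq hZ), fun ξ => (∑ i : Fin d, ‖fiberFourier (weakDeriv (ex i) W) ξ‖ ^ 2)
        + ‖fiberFourier (weakDeriv (ey d) W) ξ‖ ^ 2, ?_, ?_, ?_⟩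
    · exact (integrable_finsetSum _ fun i _ => integrable_norm_sq_fiberFourier _).add
        (integrable_norm_sq_fiberFourier _)
    · rw [integral_add hXi (hsq hZ), integral_add
        (integrable_finsetSum _ fun i _ => integrable_norm_sq_fiberFourier _)
        (integrable_norm_sq_fiberFourier _), integral_finsetSum _ fun i _ => hsq (hX i),
        integral_finsetSum _ fun i _ => integrable_norm_sq_fiberFourier _,
        integral_norm_sq_upper hZ]
      simp only [integral_norm_sq_upper (hX _)]
    · have hx := fun i : Fin d =>
        ae_fiberFourier_tangential (hW.hasWeakDeriv (n := 0) (ex i)) hW.memLp (hX i)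
      filter_upwards [ae_all_iff.2 hx] with ξ hξ
      rw [if_neg hne, EuclideanSpace.norm_eq, mul_pow, Real.sq_sqrt (by positivity),
        Finset.mul_sum, Finset.sum_mul]
      congr 1
      refine Finset.sum_congr rfl fun i _ => ?_
      rw [hξ, norm_smul]
      simp [mul_pow]

/-- Plancherel; the integrability hypothesis ensures that `fracLap` does not take its default value
`0`. -/
theorem integral_norm_sq_fracLap {σ : ℝ} (n : ℕ) (hσ : 4 * σ = n)
    {u : Lp ℂ 2 (volume : Measure (Bdry d))}
    (h : Integrable fun ξ : Bdry d =>
      (2 * Real.pi * ‖ξ‖) ^ n * ‖(𝓕 u : Lp ℂ 2 (volume : Measure (Bdry d))) ξ‖ ^ 2) :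
    ∫ x, ‖fracLap σ u x‖ ^ 2 = ∫ ξ : Bdry d,
      (2 * Real.pi * ‖ξ‖) ^ n * ‖(𝓕 u : Lp ℂ 2 (volume : Measure (Bdry d))) ξ‖ ^ 2 := by
  have he : ∀ ξ : Bdry d, ‖((2 * Real.pi * ‖ξ‖) ^ (2 * σ)) •
      (𝓕 u : Lp ℂ 2 (volume : Measure (Bdry d))) ξ‖ ^ 2
      = (2 * Real.pi * ‖ξ‖) ^ n * ‖(𝓕 u : Lp ℂ 2 (volume : Measure (Bdry d))) ξ‖ ^ 2 := by
    intro ξ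
    have h0 : 0 ≤ 2 * Real.pi * ‖ξ‖ := by positivity
    rw [norm_smul, mul_pow, Real.norm_of_nonneg (by positivity), ← Real.rpow_natCast _ n, ← hσ,
      ← Real.rpow_natCast, ← Real.rpow_mul h0]
    congr 2
    push_cast
    ring
  have hm : AEStronglyMeasurable (fun ξ : Bdry d => ((2 * Real.pi * ‖ξ‖) ^ (2 * σ)) •
      (𝓕 u : Lp ℂ 2 (volume : Measure (Bdry d))) ξ) volume :=
    (by fun_prop : Measurable fun ξ : Bdry d =>
      (2 * Real.pi * ‖ξ‖) ^ (2 * σ)).aestronglyMeasurable.smul (Lp.aestronglyMeasurable _)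
  have hL : MemLp (fun ξ : Bdry d => ((2 * Real.pi * ‖ξ‖) ^ (2 * σ)) •
      (𝓕 u : Lp ℂ 2 (volume : Measure (Bdry d))) ξ) 2 volume := by
    rw [memLp_two_iff_integrable_sq_norm hm]
    simpa only [he] using h
  have hn : ‖(𝓕⁻ hL.toLp : Lp ℂ 2 (volume : Measure (Bdry d)))‖ = ‖hL.toLp‖ := by
    rw [← Lp.norm_fourier_eq, FourierTransform.fourier_fourierInv_eq]
  rw [fracLap, dif_pos hL, integral_norm_sq_Lp, hn, ← integral_norm_sq_Lp]
  refine integral_congr_ae ?_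
  filter_upwards [hL.coeFn_toLp] with ξ hξ
  rw [hξ, he]

theorem ae_mode_energy [Nontrivial (Bdry d)] {m : ℕ} (hm : 1 ≤ m)
    {u : Lp ℂ 2 (volume : Measure (Bdry d))} {U : Bdry d × ℝ → ℂ} (hU : MemW m U)
    (hpoly : HasWeakLapPow m U 0)
    (hbc1 : ∀ k : ℕ, 2 * k + 1 ≤ m → ∃ g : Lp ℂ 2 (volume : Measure (Bdry d)),
      IsBdryLapPow k u g ∧ HasTrace (weakLapPow k U) fun x =>
        (Real.Gamma m * Real.Gamma ((m : ℝ) - 1 / 2 - k) /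
          (Real.Gamma ((m : ℝ) - k) * Real.Gamma ((m : ℝ) - 1 / 2))) • g x)
    (hbc2 : ∀ k : ℕ, 2 * k + 2 ≤ m → HasTrace (weakDeriv (ey d) (weakLapPow k U)) 0) :
    ∀ᵐ ξ, (if Even m then ‖fiberFourier (weakLapPow (m / 2) U) ξ‖ ^ 2
        else (2 * Real.pi * ‖ξ‖) ^ 2 * ‖fiberFourier (weakLapPow (m / 2) U) ξ‖ ^ 2
          + ‖fiberFourier (weakDeriv (ey d) (weakLapPow (m / 2) U)) ξ‖ ^ 2)
      = Real.Gamma m * Real.Gamma (1 / 2) / Real.Gamma ((m : ℝ) - 1 / 2) *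
        ((2 * Real.pi * ‖ξ‖) ^ (2 * m - 1) *
          ‖(𝓕 u : Lp ℂ 2 (volume : Measure (Bdry d))) ξ‖ ^ 2) := by
  have hlap : ∀ k, 2 * k ≤ m → ∀ᵐ ξ, ∀ χ ∈ halfLineTest,
      pair ((modeLap (2 * Real.pi * ‖ξ‖))^[k] χ) (fiberFourier U ξ)
        = pair χ (fiberFourier (weakLapPow k U) ξ) := fun k hk =>
    have h := hU.weakLapPow (n := m - 2 * k) (k := k) (by omega)
    ae_forall_pair_modeLap_iterate h.1 hU.memLp h.2
  have hpoly' := ae_forall_pair_modeLap_iterate hpoly hU.memLp MemLp.zero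
  have htr1 : ∀ k, 2 * k + 1 ≤ m → ∀ᵐ ξ, ∀ χ : 𝓢(ℝ, ℝ), HasCompactSupport χ →
      pair (SchwartzMap.derivCLM ℝ ℝ χ) (fiberFourier (weakLapPow k U) ξ)
        + pair χ (fiberFourier (weakDeriv (ey d) (weakLapPow k U)) ξ) = -(χ 0 •
        (Real.Gamma m * Real.Gamma ((m : ℝ) - 1 / 2 - k) /
          (Real.Gamma ((m : ℝ) - k) * Real.Gamma ((m : ℝ) - 1 / 2))) •
          ((-(2 * Real.pi * ‖ξ‖) ^ 2) ^ k •
            (𝓕 u : Lp ℂ 2 (volume : Measure (Bdry d))) ξ)) := by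
    intro k hk
    obtain ⟨g, hg, ht⟩ := hbc1 k hk
    filter_upwards [ae_forall_trace ht (.of_forall fun x => rfl), ae_fourier_bdryLapPow hg]
      with ξ h1 h2
    rwa [h2] at h1
  have htr2 : ∀ k, 2 * k + 2 ≤ m → ∀ᵐ ξ, ∀ χ : 𝓢(ℝ, ℝ), HasCompactSupport χ →
      pair (SchwartzMap.derivCLM ℝ ℝ χ)
          (fiberFourier (weakDeriv (ey d) (weakLapPow k U)) ξ)
        + pair χ (fiberFourier (weakDeriv (ey d) (weakDeriv (ey d) (weakLapPow k U))) ξ) = 0 := by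
    intro k hk
    filter_upwards [ae_forall_trace (hbc2 k hk) (g := 0) (c := 0)
      (.of_forall fun x => (zero_smul ℝ _).symm)] with ξ h1 χ hχ
    rw [h1 χ hχ, zero_smul, smul_zero, neg_zero]
  -- The half-line analysis needs `l > 0`; the zero frequency is a null set in positive dimension.
  have hne : ∀ᵐ ξ : Bdry d, ξ ≠ 0 := compl_mem_ae_iff.2 (measure_singleton 0)
  filter_upwards [hne, hpoly', ae_all_iff.2 fun k => eventually_imp_distrib_left.2 (hlap k),
    ae_all_iff.2 fun k => eventually_imp_distrib_left.2 (htr1 k),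
    ae_all_iff.2 fun k => eventually_imp_distrib_left.2 (htr2 k),
    Lp.coeFn_zero HalfLineL2 2 (volume : Measure (Bdry d))] with ξ hξ h0 h1 h2 h3 hz
  -- `weakLapPow 0 U` is a chosen representative, not `U` itself, so the two transforms have to be
  -- identified.
  have hU0 : fiberFourier U ξ = fiberFourier (weakLapPow 0 U) ξ :=
    ext_of_forall_halfLineTest (h1 0 (by omega))
  rw [hU0] at h0 h1
  rw [← mul_assoc]
  exact mode_energy (l := 2 * Real.pi * ‖ξ‖) (by positivity) hm _
    (w := fun k => fiberFourier (weakLapPow k U) ξ)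
    (z := fun k => fiberFourier (weakDeriv (ey d) (weakLapPow k U)) ξ)
    (y := fun k => fiberFourier (weakDeriv (ey d) (weakDeriv (ey d) (weakLapPow k U))) ξ)
    (fun χ hχ => by rw [h0 χ hχ, fiberFourier_zero, hz, Pi.zero_apply, map_zero]) h1 h2 h3

end Energy

end HalfSpace

theorem lemma1p1 (m : ℕ) (hm : 1 ≤ m)
    (u : Lp ℂ 2 (volume : Measure (HalfSpace.Bdry (2 * m - 1))))
    (hu : TemperedDistribution.MemSobolev ((m : ℝ) - 1 / 2) 2 (Lp.toTemperedDistribution u))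
    (U : HalfSpace.Bdry (2 * m - 1) × ℝ → ℂ)
    (hU : HalfSpace.MemW m U)
    (hpoly : HalfSpace.HasWeakLapPow m U 0)
    (hbc1 : ∀ k : ℕ, 2 * k + 1 ≤ m →
      ∃ g : Lp ℂ 2 (volume : Measure (HalfSpace.Bdry (2 * m - 1))),
        HalfSpace.IsBdryLapPow k u g ∧
        HalfSpace.HasTrace (HalfSpace.weakLapPow k U) fun x =>
          (Real.Gamma m * Real.Gamma ((m : ℝ) - 1 / 2 - k) /
            (Real.Gamma ((m : ℝ) - k) * Real.Gamma ((m : ℝ) - 1 / 2))) • g x)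
    (hbc2 : ∀ k : ℕ, 2 * k + 2 ≤ m →
      HalfSpace.HasTrace
        (HalfSpace.weakDeriv (HalfSpace.ey (2 * m - 1)) (HalfSpace.weakLapPow k U)) 0) :
    IntegrableOn (HalfSpace.gradPowSq m U)
        (HalfSpace.upper (2 * m - 1) : Set (HalfSpace.Bdry (2 * m - 1) × ℝ)) ∧
      ∫ p in HalfSpace.upper (2 * m - 1), HalfSpace.gradPowSq m U p =
        Real.Gamma m * Real.Gamma (1 / 2) / Real.Gamma ((m : ℝ) - 1 / 2) *
          ∫ x, ‖HalfSpace.fracLap ((2 * (m : ℝ) - 1) / 4) u x‖ ^ 2 := by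
  have : NeZero (2 * m - 1) := ⟨by omega⟩
  obtain ⟨hI, G, hG, hGi, hGe⟩ := HalfSpace.integrable_gradPowSq hU fun k hk => by
    obtain ⟨g, -, hg⟩ := hbc1 k hk
    exact hg.1
  refine ⟨hI, ?_⟩
  -- Since the constant is nonzero, the integrability of `G` passes to `(2π‖ξ‖)^(2m-1) |û|²`.
  have hC : Real.Gamma m * Real.Gamma (1 / 2) / Real.Gamma ((m : ℝ) - 1 / 2) ≠ 0 := by
    have hm' : (1 : ℝ) ≤ m := by exact_mod_cast hm
    have h1 := Real.Gamma_pos_of_pos (s := m) (by linarith)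
    have h2 := Real.Gamma_pos_of_pos (s := 1 / 2) (by norm_num)
    have h3 := Real.Gamma_pos_of_pos (s := (m : ℝ) - 1 / 2) (by linarith)
    positivity
  have hGe' := hGe.and (HalfSpace.ae_mode_energy hm hU hpoly hbc1 hbc2) |>.mono fun ξ h =>
    h.1.trans h.2
  have hi := hG.congr hGe'
  rw [hGi, integral_congr_ae hGe', integral_const_mul,
    HalfSpace.integral_norm_sq_fracLap (2 * m - 1) _
      ((integrable_const_mul_iff (IsUnit.mk0 _ hC) _).1 hi)]
  rw [Nat.cast_sub (by omega)]
  push_cast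
  ring
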